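/- **Definitions.** Write $|U|$ for the diameter of a set $U$. Let $F \subseteq \mathbb{R}^2$ be bounded. For $0\le\theta\le 1$ the lower and upper $\theta$-intermediate dimensions of $F$ are $$\underline{\dim}_\theta F=\inf\Big\{s\ge 0:\ \forall \epsilon>0\ \forall\delta_0>0\ \exists\, 0<\delta\le\delta_0 \text{ and a finite or countable cover } \{U_i\} \text{ of } F \text{ with } \delta^{1/\theta}\le|U_i|\le\delta \text{ for all } i \text{ and } \textstyle\sum_i|U_i|^s\le\epsilon\Big\},$$ $$\overline{\dim}_\theta F=\inf\Big\{s\ge 0:\ \forall \epsilon>0\ \exists\delta_0>0\ \forall\, 0<\delta\le\delta_0 \text{ there is a finite or countable cover } \{U_i\} \text{ of } F \text{ with } \delta^{1/\theta}\le|U_i|\le\delta \text{ for all } i \text{ and } \textstyle\sum_i|U_i|^s\le\epsilon\Big\},$$ where for $\theta=0$ the lower bound $\delta^{1/\theta}$ is read as $0$. Let $n>m\ge 2$ be integers and let $D\subseteq\{0,\dots,m-1\}\times\{0,\dots,n-1\}$. For $(p,q)\in D$ let $S_{(p,q)}(x,y)=\big(\tfrac{x+p}{m},\tfrac{y+q}{n}\big)$.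 The Bedford–McMullen carpet of $D$ is the unique non-empty compact set $F\subseteq[0,1]^2$ with $F=\bigcup_{(p,q)\in D}S_{(p,q)}(F)$. Let $n_p$ be the number of $q$ with $(p,q)\in D$, assume that the non-zero numbers $n_p$ are not all equal, and let $a=\max_p n_p$ be the maximal column count. **Proposition.** With $m,n,D,F,a$ as above, for every $\theta$ with $0<\theta<\tfrac14(\log_n m)^2$, $$\overline{\dim}_\theta F\ \le\ \dim_{\mathrm H}F+\bigg(\frac{2\log(\log_m n)\,\log a}{\log n}\bigg)\frac{1}{-\log\theta},$$ where $\dim_{\mathrm H}$ is the Hausdorff dimension. In particular, $\theta\mapsto\underline{\dim}_\theta F$ and $\theta\mapsto\overline{\dim}_\theta F$ are continuous at $\theta=0$, and they are continuous on $[0,1]$. -/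

import Mathlib

open Set MeasureTheory
open scoped ENNReal NNReal

/-! ### Intermediate dimensions -/

/-- A single admissible cover in the definition of the `θ`-intermediate dimensions: a finite or
countable family `U` of sets covering `F`, with `δ ^ (1 / θ) ≤ |U i| ≤ δ` for every `i`, and with
`∑ |U i| ^ s ≤ ε`. Here `|U|` is the diameter, as an extended nonnegative real. For `θ = 0` the
lower bound is `δ ^ ∞ = 0`, that is, there is no lower restriction on the diameters. -/
def HasAdmissibleCover {X : Type*} [PseudoEMetricSpace X] (θ : ℝ) (F : Set X) (s : ℝ≥0)
    (ε δ : ℝ) : Prop :=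
  ∃ (ι : Type) (_ : Countable ι) (U : ι → Set X),
    F ⊆ ⋃ i, U i ∧
    (∀ i, (0 < θ → ENNReal.ofReal (δ ^ (1 / θ)) ≤ Metric.ediam (U i)) ∧
      Metric.ediam (U i) ≤ ENNReal.ofReal δ) ∧
    ∑' i, Metric.ediam (U i) ^ (s : ℝ) ≤ ENNReal.ofReal ε

/-- The lower `θ`-intermediate dimension (for `0 ≤ θ ≤ 1` and bounded `F`). -/
noncomputable def lowerIntermediateDim {X : Type*} [PseudoEMetricSpace X] (θ : ℝ) (F : Set X) :
    ℝ≥0∞ :=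
  ⨅ (s : ℝ≥0) (_ : ∀ ε : ℝ, 0 < ε → ∀ δ₀ : ℝ, 0 < δ₀ →
    ∃ δ : ℝ, 0 < δ ∧ δ ≤ δ₀ ∧ HasAdmissibleCover θ F s ε δ), (s : ℝ≥0∞)

/-- The upper `θ`-intermediate dimension (for `0 ≤ θ ≤ 1` and bounded `F`). -/
noncomputable def upperIntermediateDim {X : Type*} [PseudoEMetricSpace X] (θ : ℝ) (F : Set X) :
    ℝ≥0∞ :=
  ⨅ (s : ℝ≥0) (_ : ∀ ε : ℝ, 0 < ε → ∃ δ₀ : ℝ, 0 < δ₀ ∧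
    ∀ δ : ℝ, 0 < δ → δ ≤ δ₀ → HasAdmissibleCover θ F s ε δ), (s : ℝ≥0∞)

/-! ### Bedford-McMullen carpets -/

/-- The affine contraction `(x, y) ↦ ((x + p) / m, (y + q) / n)` of the plane, for
`ℓ = (p, q)` with `0 ≤ p < m` and `0 ≤ q < n`. -/
noncomputable def carpetMap {m n : ℕ} (ℓ : Fin m × Fin n) (z : EuclideanSpace ℝ (Fin 2)) :
    EuclideanSpace ℝ (Fin 2) :=
  !₂[(z 0 + ((ℓ.1 : ℕ) : ℝ)) / (m : ℝ), (z 1 + ((ℓ.2 : ℕ) : ℝ)) / (n : ℝ)]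

/-- `F` is the Bedford-McMullen carpet with digit set `D`: the nonempty compact subset of the unit
square with `F = ⋃ ℓ ∈ D, S_ℓ(F)`. See `existsUnique_isBedfordMcMullenCarpet`. -/
structure IsBedfordMcMullenCarpet {m n : ℕ} (D : Finset (Fin m × Fin n))
    (F : Set (EuclideanSpace ℝ (Fin 2))) : Prop where
  nonempty : F.Nonempty
  isCompact : IsCompact F
  subset_square : ∀ z ∈ F, ∀ j, z j ∈ Icc (0 : ℝ) 1
  eq_iUnion : F = ⋃ ℓ ∈ D, carpetMap ℓ '' F

/-- The number `n_p` of `q` with `(p, q) ∈ D`, i.e. of selected rectangles in column `p`. -/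
def columnCount {m n : ℕ} (D : Finset (Fin m × Fin n)) (p : Fin m) : ℕ :=
  (D.filter fun ℓ => ℓ.1 = p).card

/-- The nonzero column counts of `D` are not all equal. -/
def NonuniformColumns {m n : ℕ} (D : Finset (Fin m × Fin n)) : Prop :=
  ∃ p p' : Fin m, columnCount D p ≠ 0 ∧ columnCount D p' ≠ 0 ∧ columnCount D p ≠ columnCount D p'

/-- The number `a`: the maximum, over `ℓ ∈ D`, of the number `a_ℓ` of elements of `D` in the same
column as `ℓ`. -/
def maxColumnCount {m n : ℕ} (D : Finset (Fin m × Fin n)) : ℕ :=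
  D.sup fun ℓ => columnCount D ℓ.1

theorem dist_carpetMap_le {m n : ℕ} (hm : 2 ≤ m) (hn : 2 ≤ n) (ℓ : Fin m × Fin n)
    (z w : EuclideanSpace ℝ (Fin 2)) :
    dist (carpetMap ℓ z) (carpetMap ℓ w) ≤ dist z w / 2 := by
  have key : ∀ (b : ℕ), 2 ≤ b → ∀ u v c : ℝ,
      ((u + c) / b - (v + c) / b) ^ 2 ≤ (u - v) ^ 2 / 4 := by
    intro b hb u v c
    have hb' : (2 : ℝ) ≤ b := by exact_mod_cast hb
    have : (u + c) / b - (v + c) / b = (u - v) / b := by ring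
    rw [this, div_pow]
    apply div_le_div_of_nonneg_left (sq_nonneg _) (by norm_num)
    nlinarith
  have h0 := key m hm (z 0) (w 0) (ℓ.1 : ℕ)
  have h1 := key n hn (z 1) (w 1) (ℓ.2 : ℕ)
  rw [EuclideanSpace.dist_eq, EuclideanSpace.dist_eq]
  simp only [Fin.sum_univ_two, Real.dist_eq, sq_abs]
  apply Real.sqrt_le_iff.mpr
  refine ⟨by positivity, ?_⟩
  rw [div_pow, Real.sq_sqrt (by positivity)]
  simp only [carpetMap, PiLp.toLp_apply, Matrix.cons_val_zero, Matrix.cons_val_one]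
  linarith

theorem IsBedfordMcMullenCarpet.subset {m n : ℕ} (hm : 2 ≤ m) (hn : 2 ≤ n)
    {D : Finset (Fin m × Fin n)} {F G : Set (EuclideanSpace ℝ (Fin 2))}
    (hF : IsBedfordMcMullenCarpet D F) (hG : IsBedfordMcMullenCarpet D G) : F ⊆ G := by
  obtain ⟨x, hx, hmax⟩ := hF.isCompact.exists_isMaxOn hF.nonempty
    (Metric.continuous_infDist_pt G).continuousOn
  have hx2 := hx
  rw [hF.eq_iUnion] at hx2
  obtain ⟨ℓ, hℓ, x', hx', rfl⟩ := by simpa only [mem_iUnion, exists_prop] using hx2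
  obtain ⟨y, hy, hxy⟩ := hG.isCompact.exists_infDist_eq_dist hG.nonempty x'
  have hy' : carpetMap ℓ y ∈ G := by
    rw [hG.eq_iUnion]
    exact mem_iUnion₂.mpr ⟨ℓ, hℓ, y, hy, rfl⟩
  have h1 := Metric.infDist_le_dist_of_mem (x := carpetMap ℓ x') hy'
  have h2 := dist_carpetMap_le hm hn ℓ x' y
  have h3 : Metric.infDist x' G ≤ Metric.infDist (carpetMap ℓ x') G := hmax hx'
  intro z hz
  have h4 : Metric.infDist z G ≤ Metric.infDist (carpetMap ℓ x') G := hmax hz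
  have h5 : Metric.infDist z G = 0 :=
    le_antisymm (by linarith) Metric.infDist_nonneg
  exact (hG.isCompact.isClosed.mem_iff_infDist_zero hG.nonempty).mpr h5

/-- For a nonempty digit set there is exactly one Bedford-McMullen carpet. -/
theorem existsUnique_isBedfordMcMullenCarpet {m n : ℕ} (hm : 2 ≤ m) (hn : 2 ≤ n)
    (D : Finset (Fin m × Fin n)) (hD : D.Nonempty) :
    ∃! F : Set (EuclideanSpace ℝ (Fin 2)), IsBedfordMcMullenCarpet D F := by
  let τ : (ℕ → D) → EuclideanSpace ℝ (Fin 2) := fun i =>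
    !₂[Real.ofDigits fun k => (i k).1.1, Real.ofDigits fun k => (i k).1.2]
  have hτ : ∀ i : ℕ → D, τ i = carpetMap (i 0).1 (τ fun k => i (k + 1)) := by
    intro i
    have e : ∀ {b : ℕ} (d : ℕ → Fin b),
        Real.ofDigits d = (Real.ofDigits (fun k => d (k + 1)) + ((d 0 : ℕ) : ℝ)) / b := by
      intro b d
      rw [Real.ofDigits_eq_sum_add_ofDigits d 1]
      simp [Real.ofDigitsTerm]
      ring
    simp only [τ, carpetMap, Matrix.cons_val_zero, Matrix.cons_val_one]
    rw [e fun k => (i k).1.1, e fun k => (i k).1.2]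
  have hcont : Continuous τ := by
    have h1 : Continuous fun i : ℕ → D => Real.ofDigits fun k => (i k).1.1 :=
      Real.continuous_ofDigits.comp (continuous_pi fun k =>
        (continuous_of_discreteTopology (f := fun d : D => d.1.1)).comp (continuous_apply k))
    have h2 : Continuous fun i : ℕ → D => Real.ofDigits fun k => (i k).1.2 :=
      Real.continuous_ofDigits.comp (continuous_pi fun k =>
        (continuous_of_discreteTopology (f := fun d : D => d.1.2)).comp (continuous_apply k))
    refine (PiLp.continuous_toLp 2 _).comp (continuous_pi fun j => ?_)
    fin_cases j
    · exact h1
    · exact h2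
  have hcarpet : IsBedfordMcMullenCarpet D (range τ) := by
    refine ⟨?_, isCompact_range hcont, ?_, ?_⟩
    · obtain ⟨ℓ, hℓ⟩ := hD
      exact ⟨τ fun _ => ⟨ℓ, hℓ⟩, mem_range_self _⟩
    · rintro _ ⟨i, rfl⟩ j
      fin_cases j
      · exact ⟨Real.ofDigits_nonneg _, Real.ofDigits_le_one _⟩
      · exact ⟨Real.ofDigits_nonneg _, Real.ofDigits_le_one _⟩
    · ext z
      simp only [mem_iUnion, exists_prop]
      constructor
      · rintro ⟨i, rfl⟩
        exact ⟨(i 0).1, (i 0).2, _, mem_range_self _, (hτ i).symm⟩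
      · rintro ⟨ℓ, hℓ, _, ⟨i, rfl⟩, rfl⟩
        refine ⟨fun k => Nat.casesOn k ⟨ℓ, hℓ⟩ i, ?_⟩
        exact hτ _
  exact ⟨range τ, hcarpet, fun G hG =>
    Subset.antisymm (hG.subset hm hn hcarpet) (hcarpet.subset hm hn hG)⟩

/-!
Let `c = log_m n`, let `a_ℓ` be the number of digits in the column of `ℓ`, and put
`Z = ∑ a_ℓ ^ (1 / c - 1)`. McMullen's measure is the Bernoulli measure on digit sequences that gives
`ℓ` the weight `a_ℓ ^ (1 / c - 1) / Z`. An approximate square of level `k` prescribes the first `k`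
digits and the first `L(k) = ⌊c k⌋` columns; it has size about `n ^ (-k)`. With
`d = log_m Z` and `S_k` the sum of `log a_ℓ` over the first `k` digits, the logarithm of its mass is
`-k d log n + k (S_{L(k)} / L(k) - S_k / k)` up to a bounded error
(`mcMullenMeasure_approxSquare`, `log_approxSquare_le`, `le_log_approxSquare`).

*The Hausdorff dimension is at least `d`.* By the strong law of large numbers the averages `S_k / k`
converge almost surely, so almost every point eventually has approximate squares of mass at most
`n ^ (-k s)` for each `s < d`. A set of diameter `n ^ (-k)` meets boundedly many approximate squares
of level `k`, and the mass distribution principle applies (`le_dimH_range_codingMap`).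

*The intermediate dimensions are at most `d + log a / (r log n)`*, where `a` is the maximal column
count and `c ^ (r - 1) < 1 / θ`. Along `K, L(K), L(L(K)), …` the differences of the averages
telescope to a number that is at least `-log a`, so for every point one of the first `r` levels has
an approximate square of mass at least a constant times `n ^ (-k (d + log a / (r log n)))`. At each
level there are few squares of such mass, and these `r` levels give diameters between
`δ ^ (1 / θ)` and `δ` (`exists_cover_codingMap`, `upperIntermediateDim_range_codingMap_le`). Taking
`r` to be half of `log (1 / θ) / log c`, rounded up, gives the bound, in fact for all `θ < 1`.

*Continuity.* Both dimensions increase with `θ` and are at least the Hausdorff dimension, so the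
bound gives continuity at `0`. For any set they satisfy `(θ / φ) dim_φ ≤ dim_θ` when
`0 < θ ≤ φ ≤ 1`, because small sets of a cover may be replaced by boundedly many balls of diameter
`δ ^ (1 / φ)` (`exists_hasAdmissibleCover_of_le`); this gives continuity on `(0, 1]`.
-/

open Filter Topology

/-! ### General properties of intermediate dimensions -/

theorem HasAdmissibleCover.anti_theta {X : Type*} [PseudoEMetricSpace X] {θ φ : ℝ} {F : Set X}
    {s : ℝ≥0} {ε δ : ℝ} (hθφ : θ ≤ φ) (hδ : 0 < δ) (hδ1 : δ ≤ 1)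
    (h : HasAdmissibleCover φ F s ε δ) : HasAdmissibleCover θ F s ε δ := by
  obtain ⟨ι, hι, U, hF, hU, hsum⟩ := h
  refine ⟨ι, hι, U, hF, fun i => ⟨fun hθ => ?_, (hU i).2⟩, hsum⟩
  refine le_trans (ENNReal.ofReal_le_ofReal ?_) ((hU i).1 (hθ.trans_le hθφ))
  exact Real.rpow_le_rpow_of_exponent_ge hδ hδ1 (one_div_le_one_div_of_le hθ hθφ)

theorem lowerIntermediateDim_mono {X : Type*} [PseudoEMetricSpace X] (F : Set X) :
    Monotone fun θ : ℝ => lowerIntermediateDim θ F := by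
  intro θ φ hθφ
  refine le_iInf₂ fun s hs => iInf₂_le s fun ε hε δ₀ hδ₀ => ?_
  obtain ⟨δ, hδ, hle, hc⟩ := hs ε hε (min δ₀ 1) (lt_min hδ₀ one_pos)
  exact ⟨δ, hδ, hle.trans (min_le_left _ _), hc.anti_theta hθφ hδ (hle.trans (min_le_right _ _))⟩

theorem upperIntermediateDim_mono {X : Type*} [PseudoEMetricSpace X] (F : Set X) :
    Monotone fun θ : ℝ => upperIntermediateDim θ F := by
  intro θ φ hθφ
  refine le_iInf₂ fun s hs => iInf₂_le s fun ε hε => ?_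
  obtain ⟨δ₀, hδ₀, hc⟩ := hs ε hε
  exact ⟨min δ₀ 1, lt_min hδ₀ one_pos, fun δ hδ hle =>
    (hc δ hδ (hle.trans (min_le_left _ _))).anti_theta hθφ hδ (hle.trans (min_le_right _ _))⟩

theorem lowerIntermediateDim_le_upperIntermediateDim {X : Type*} [PseudoEMetricSpace X] (θ : ℝ)
    (F : Set X) : lowerIntermediateDim θ F ≤ upperIntermediateDim θ F := by
  refine le_iInf₂ fun s hs => iInf₂_le s fun ε hε δ₀ hδ₀ => ?_
  obtain ⟨δ₁, hδ₁, hc⟩ := hs ε hε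
  exact ⟨min δ₀ δ₁, lt_min hδ₀ hδ₁, min_le_left _ _, hc _ (lt_min hδ₀ hδ₁) (min_le_right _ _)⟩

/-- Admissible covers of arbitrarily small mesh with bounded `s`-sums keep the `s`-dimensional
Hausdorff measure finite. -/
theorem dimH_le_lowerIntermediateDim {X : Type*} [EMetricSpace X] (θ : ℝ) (F : Set X) :
    dimH F ≤ lowerIntermediateDim θ F := by
  borelize X
  refine le_iInf₂ fun s hs => dimH_le_of_hausdorffMeasure_ne_top ?_
  choose δ hδ hδle hc using fun k : ℕ => hs 1 one_pos (1 / ((k : ℝ) + 1)) (by positivity)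
  choose ι hι U hF hU hsum using hc
  have hlim : Tendsto (fun k => ENNReal.ofReal (δ k)) atTop (𝓝 0) := by
    have : Tendsto δ atTop (𝓝 0) :=
      squeeze_zero (fun k => (hδ k).le) hδle tendsto_one_div_add_atTop_nhds_zero_nat
    simpa using ENNReal.tendsto_ofReal this
  have := Measure.hausdorffMeasure_le_liminf_tsum (s : ℝ) F (l := atTop)
    (fun k => ENNReal.ofReal (δ k)) hlim U (Eventually.of_forall fun k i => (hU k i).2)
    (Eventually.of_forall hF)
  refine ne_top_of_le_ne_top ENNReal.one_ne_top (this.trans ?_)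
  refine (liminf_le_liminf (Eventually.of_forall hsum)).trans ?_
  simp

/-- In a finite-dimensional space every ball of radius `r` is covered by a number of balls of radius
`r / 2` that does not depend on `r`: the centres are those of a fixed finite net, rescaled. -/
theorem exists_forall_mem_closedBall_half (E : Type*) [NormedAddCommGroup E] [NormedSpace ℝ E]
    [FiniteDimensional ℝ E] : ∃ (N : ℕ) (v : Fin N → E), ∀ r : ℝ, 0 < r → ∀ x y : E,
      dist y x ≤ r → ∃ j, y ∈ Metric.closedBall (x + r • v j) (r / 2) := by
  have : ProperSpace E := FiniteDimensional.proper ℝ E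
  obtain ⟨t, -, htf, ht⟩ := Metric.totallyBounded_iff.mp
    (isCompact_closedBall (0 : E) 1).totallyBounded (1 / 2) (by norm_num) |>.imp
    fun t h => (⟨trivial, h.1, h.2⟩ : True ∧ _ ∧ _)
  have := htf.fintype
  refine ⟨_, fun j => ((Fintype.equivFin t).symm j : E), fun r hr x y hxy => ?_⟩
  have hmem : r⁻¹ • (y - x) ∈ Metric.closedBall (0 : E) 1 := by
    rw [mem_closedBall_zero_iff, norm_smul, norm_inv, Real.norm_of_nonneg hr.le, ← dist_eq_norm]
    exact (inv_mul_le_one₀ hr).mpr hxy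
  obtain ⟨v, hv, hvb⟩ := mem_iUnion₂.mp (ht hmem)
  refine ⟨Fintype.equivFin t ⟨v, hv⟩, ?_⟩
  simp only [Equiv.symm_apply_apply]
  rw [Metric.mem_ball, dist_eq_norm] at hvb
  have : y - (x + r • v) = r • (r⁻¹ • (y - x) - v) := by
    rw [smul_sub, smul_inv_smul₀ hr.ne']; abel
  rw [Metric.mem_closedBall, dist_eq_norm, this, norm_smul, Real.norm_of_nonneg hr.le]
  nlinarith

theorem ediam_closedBall_eq {E : Type*} [NormedAddCommGroup E] [NormedSpace ℝ E] [Nontrivial E]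
    (x : E) {r : ℝ} (hr : 0 ≤ r) : Metric.ediam (Metric.closedBall x r) = ENNReal.ofReal (2 * r) := by
  rw [← Metric.diam_closedBall_eq x hr, Metric.diam,
    ENNReal.ofReal_toReal Metric.isBounded_closedBall.ediam_ne_top]

/-- Replacing the sets of diameter below `δ ^ (1 / φ)` by boundedly many balls of that diameter
turns an admissible cover for `θ` into one for `φ`; since the original diameters are at least
`δ ^ (1 / θ)`, raising the exponent by the factor `φ / θ` compensates for the enlargement. -/
theorem exists_hasAdmissibleCover_of_le {E : Type*} [NormedAddCommGroup E] [NormedSpace ℝ E]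
    [FiniteDimensional ℝ E] [Nontrivial E] :
    ∃ N : ℕ, ∀ (θ φ : ℝ) (F : Set E) (s t : ℝ≥0) (ε δ : ℝ), 0 < θ → θ ≤ φ → φ ≤ 1 → 0 < δ →
      δ ≤ 1 → (t : ℝ) = s * (φ / θ) → HasAdmissibleCover θ F s ε δ →
      HasAdmissibleCover φ F t (N * ε) δ := by
  obtain ⟨N, w, hw⟩ := exists_forall_mem_closedBall_half E
  refine ⟨N, ?_⟩
  rintro θ φ F s t ε δ hθ hθφ hφ hδ hδ1 hst ⟨ι, hι, U, hF, hU, hsum⟩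
  have hφ0 : 0 < φ := hθ.trans_le hθφ
  set r : ℝ := δ ^ (1 / φ) with hr
  have hr0 : 0 < r := Real.rpow_pos_of_pos hδ _
  have hrδ : r ≤ δ := by
    have := Real.rpow_le_rpow_of_exponent_ge hδ hδ1 (one_le_one_div hφ0 hφ)
    rwa [Real.rpow_one] at this
  have hst' : (s : ℝ) ≤ t := by
    rw [hst]
    exact le_mul_of_one_le_right s.2 ((one_le_div hθ).mpr hθφ)
  classical
  let x : ι → E := fun i => if h : (U i).Nonempty then h.some else 0
  let V : ι × Fin N → Set E := fun i =>
    if ENNReal.ofReal r ≤ Metric.ediam (U i.1) then U i.1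
    else Metric.closedBall (x i.1 + r • w i.2) (r / 2)
  refine ⟨ι × Fin N, inferInstance, V, ?_, ?_, ?_⟩
  · intro y hy
    obtain ⟨i, hi⟩ := mem_iUnion.mp (hF hy)
    have hne : (U i).Nonempty := ⟨y, hi⟩
    by_cases hle : ENNReal.ofReal r ≤ Metric.ediam (U i)
    · obtain ⟨v, -⟩ := hw 1 one_pos (0 : E) 0 (by simp)
      refine mem_iUnion.mpr ⟨(i, v), ?_⟩
      simpa [V, hle] using hi
    · have hx : x i ∈ U i := by simpa [x, hne] using hne.some_mem
      have hd : dist y (x i) ≤ r := by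
        have := (Metric.edist_le_ediam_of_mem hi hx).trans (not_le.mp hle).le
        rwa [edist_dist, ENNReal.ofReal_le_ofReal_iff hr0.le] at this
      obtain ⟨v, hyv⟩ := hw r hr0 (x i) y hd
      refine mem_iUnion.mpr ⟨(i, v), ?_⟩
      simpa only [V, hle, if_false] using hyv
  · rintro ⟨i, v⟩
    by_cases hle : ENNReal.ofReal r ≤ Metric.ediam (U i)
    · simp only [V, hle, if_true]
      exact ⟨fun _ => hle, (hU i).2⟩
    · simp only [V, hle, if_false]
      rw [ediam_closedBall_eq _ (by positivity), mul_div_cancel₀ _ two_ne_zero]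
      exact ⟨fun _ => le_rfl, ENNReal.ofReal_le_ofReal hrδ⟩
  · have key : ∀ p : ι × Fin N, Metric.ediam (V p) ^ (t : ℝ) ≤ Metric.ediam (U p.1) ^ (s : ℝ) := by
      rintro ⟨i, v⟩
      by_cases hle : ENNReal.ofReal r ≤ Metric.ediam (U i)
      · simp only [V, hle, if_true]
        refine ENNReal.rpow_le_rpow_of_exponent_ge ((hU i).2.trans ?_) hst'
        simpa using hδ1
      · simp only [V, hle, if_false]
        rw [ediam_closedBall_eq _ (by positivity), mul_div_cancel₀ _ two_ne_zero]
        refine le_trans (le_of_eq ?_) (ENNReal.rpow_le_rpow ((hU i).1 hθ) s.2)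
        rw [ENNReal.ofReal_rpow_of_pos hr0, ENNReal.ofReal_rpow_of_pos (by positivity), hr,
          ← Real.rpow_mul hδ.le, ← Real.rpow_mul hδ.le, hst]
        congr 2
        field_simp
    calc ∑' p, Metric.ediam (V p) ^ (t : ℝ) ≤ ∑' p : ι × Fin N, Metric.ediam (U p.1) ^ (s : ℝ) :=
          ENNReal.tsum_le_tsum key
      _ = N * ∑' i, Metric.ediam (U i) ^ (s : ℝ) := by
          rw [ENNReal.tsum_prod (f := fun i (_ : Fin N) => Metric.ediam (U i) ^ (s : ℝ)),
            ← ENNReal.tsum_mul_left]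
          simp [tsum_fintype]
      _ ≤ N * ENNReal.ofReal ε := by gcongr
      _ = ENNReal.ofReal (N * ε) := by
          rw [ENNReal.ofReal_mul (by positivity), ENNReal.ofReal_natCast]

theorem ofReal_mul_lowerIntermediateDim_le {E : Type*} [NormedAddCommGroup E] [NormedSpace ℝ E]
    [FiniteDimensional ℝ E] [Nontrivial E] (F : Set E) {θ φ : ℝ} (hθ : 0 < θ) (hθφ : θ ≤ φ)
    (hφ : φ ≤ 1) :
    ENNReal.ofReal (θ / φ) * lowerIntermediateDim φ F ≤ lowerIntermediateDim θ F := by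
  obtain ⟨N, hN⟩ := exists_hasAdmissibleCover_of_le (E := E)
  have hφ0 : 0 < φ := hθ.trans_le hθφ
  refine le_iInf₂ fun s hs => ?_
  let t : ℝ≥0 := s * Real.toNNReal (φ / θ)
  have ht : (t : ℝ) = s * (φ / θ) := by
    simp [t, Real.coe_toNNReal _ (div_nonneg hφ0.le hθ.le)]
  have hle : lowerIntermediateDim φ F ≤ t := by
    refine iInf₂_le t fun ε hε δ₀ hδ₀ => ?_
    obtain ⟨δ, hδ, hδle, hc⟩ := hs (ε / (N + 1)) (by positivity) (min δ₀ 1) (lt_min hδ₀ one_pos)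
    refine ⟨δ, hδ, hδle.trans (min_le_left _ _), ?_⟩
    obtain ⟨ι, hι, U, h1, h2, h3⟩ :=
      hN θ φ F s t _ δ hθ hθφ hφ hδ (hδle.trans (min_le_right _ _)) ht hc
    refine ⟨ι, hι, U, h1, h2, h3.trans (ENNReal.ofReal_le_ofReal ?_)⟩
    rw [mul_div_assoc', div_le_iff₀ (by positivity)]
    nlinarith
  calc ENNReal.ofReal (θ / φ) * lowerIntermediateDim φ F ≤ ENNReal.ofReal (θ / φ) * t := by gcongr
    _ = s := by
      rw [← ENNReal.ofReal_coe_nnreal, ht, ← ENNReal.ofReal_mul (by positivity),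
        ← ENNReal.ofReal_coe_nnreal]
      congr 1
      field_simp

theorem ofReal_mul_upperIntermediateDim_le {E : Type*} [NormedAddCommGroup E] [NormedSpace ℝ E]
    [FiniteDimensional ℝ E] [Nontrivial E] (F : Set E) {θ φ : ℝ} (hθ : 0 < θ) (hθφ : θ ≤ φ)
    (hφ : φ ≤ 1) :
    ENNReal.ofReal (θ / φ) * upperIntermediateDim φ F ≤ upperIntermediateDim θ F := by
  obtain ⟨N, hN⟩ := exists_hasAdmissibleCover_of_le (E := E)
  have hφ0 : 0 < φ := hθ.trans_le hθφ
  refine le_iInf₂ fun s hs => ?_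
  let t : ℝ≥0 := s * Real.toNNReal (φ / θ)
  have ht : (t : ℝ) = s * (φ / θ) := by
    simp [t, Real.coe_toNNReal _ (div_nonneg hφ0.le hθ.le)]
  have hle : upperIntermediateDim φ F ≤ t := by
    refine iInf₂_le t fun ε hε => ?_
    obtain ⟨δ₀, hδ₀, hc⟩ := hs (ε / (N + 1)) (by positivity)
    refine ⟨min δ₀ 1, lt_min hδ₀ one_pos, fun δ hδ hδle => ?_⟩
    obtain ⟨ι, hι, U, h1, h2, h3⟩ := hN θ φ F s t _ δ hθ hθφ hφ hδ
      (hδle.trans (min_le_right _ _)) ht (hc δ hδ (hδle.trans (min_le_left _ _)))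
    refine ⟨ι, hι, U, h1, h2, h3.trans (ENNReal.ofReal_le_ofReal ?_)⟩
    rw [mul_div_assoc', div_le_iff₀ (by positivity)]
    nlinarith
  calc ENNReal.ofReal (θ / φ) * upperIntermediateDim φ F ≤ ENNReal.ofReal (θ / φ) * t := by gcongr
    _ = s := by
      rw [← ENNReal.ofReal_coe_nnreal, ht, ← ENNReal.ofReal_mul (by positivity),
        ← ENNReal.ofReal_coe_nnreal]
      congr 1
      field_simp

/-- A monotone function on `[0, 1]` that satisfies `(θ / φ) f(φ) ≤ f(θ)` for `0 < θ ≤ φ ≤ 1` is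
continuous on `(0, 1]`: near `θ₀` it lies between `min 1 (θ / θ₀) f(θ₀)` and
`max 1 (θ / θ₀) f(θ₀)`. -/
theorem continuousWithinAt_of_monotone_of_div_mul_le {f : ℝ → ℝ≥0∞} (hf : Monotone f)
    (hr : ∀ {θ φ : ℝ}, 0 < θ → θ ≤ φ → φ ≤ 1 → ENNReal.ofReal (θ / φ) * f φ ≤ f θ)
    {θ₀ : ℝ} (h0 : 0 < θ₀) (h1 : θ₀ ≤ 1) : ContinuousWithinAt f (Icc 0 1) θ₀ := by
  have hlim : ∀ g : ℝ → ℝ, Continuous g → g θ₀ = 1 →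
      Tendsto (fun θ => ENNReal.ofReal (g θ) * f θ₀) (𝓝[Icc 0 1] θ₀) (𝓝 (f θ₀)) := by
    intro g hg hg1
    have h2 : Tendsto (fun θ => ENNReal.ofReal (g θ)) (𝓝[Icc 0 1] θ₀) (𝓝 1) := by
      have := ENNReal.tendsto_ofReal (hg.tendsto θ₀)
      rw [hg1, ENNReal.ofReal_one] at this
      exact this.mono_left nhdsWithin_le_nhds
    simpa using ENNReal.Tendsto.mul_const h2 (Or.inl one_ne_zero)
  refine tendsto_of_tendsto_of_tendsto_of_le_of_le'
    (hlim (fun θ => min 1 (θ / θ₀)) (by fun_prop) (by simp [h0.ne']))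
    (hlim (fun θ => max 1 (θ / θ₀)) (by fun_prop) (by simp [h0.ne'])) ?_ ?_
  · filter_upwards [mem_nhdsWithin_of_mem_nhds (lt_mem_nhds h0)] with θ hθ
    rcases le_total θ θ₀ with h | h
    · refine le_trans ?_ (hr hθ h h1)
      gcongr
      exact min_le_right _ _
    · refine le_trans ?_ (hf h)
      refine mul_le_of_le_one_left' ?_
      rw [← ENNReal.ofReal_one]
      exact ENNReal.ofReal_le_ofReal (min_le_left _ _)
  · filter_upwards [mem_nhdsWithin_of_mem_nhds (lt_mem_nhds h0), self_mem_nhdsWithin] with θ hθ hθ1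
    rcases le_total θ θ₀ with h | h
    · refine (hf h).trans ?_
      refine le_mul_of_one_le_left' ?_
      rw [← ENNReal.ofReal_one]
      exact ENNReal.ofReal_le_ofReal (le_max_left _ _)
    · calc f θ = ENNReal.ofReal (θ / θ₀) * (ENNReal.ofReal (θ₀ / θ) * f θ) := by
            rw [← mul_assoc, ← ENNReal.ofReal_mul (by positivity), div_mul_div_cancel₀ h0.ne',
              div_self hθ.ne', ENNReal.ofReal_one, one_mul]
        _ ≤ ENNReal.ofReal (max 1 (θ / θ₀)) * f θ₀ := by
            gcongr
            · exact le_max_right _ _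
            · exact hr h0 h hθ1.2

/-! ### Symbolic coding of the carpet -/

/-- The point of the plane with base-`m` digits `(i k).1` and base-`n` digits `(i k).2`. -/
noncomputable def codingMap {m n : ℕ} (D : Finset (Fin m × Fin n)) (i : ℕ → D) :
    EuclideanSpace ℝ (Fin 2) :=
  !₂[Real.ofDigits fun k => (i k).1.1, Real.ofDigits fun k => (i k).1.2]

@[simp] theorem codingMap_apply_zero {m n : ℕ} (D : Finset (Fin m × Fin n)) (i : ℕ → D) :
    codingMap D i 0 = Real.ofDigits fun k => (i k).1.1 := rfl

@[simp] theorem codingMap_apply_one {m n : ℕ} (D : Finset (Fin m × Fin n)) (i : ℕ → D) :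
    codingMap D i 1 = Real.ofDigits fun k => (i k).1.2 := rfl

theorem continuous_codingMap {m n : ℕ} (D : Finset (Fin m × Fin n)) :
    Continuous (codingMap D) := by
  have h1 : Continuous fun i : ℕ → D => Real.ofDigits fun k => (i k).1.1 :=
    Real.continuous_ofDigits.comp (continuous_pi fun k =>
      (continuous_of_discreteTopology (f := fun d : D => d.1.1)).comp (continuous_apply k))
  have h2 : Continuous fun i : ℕ → D => Real.ofDigits fun k => (i k).1.2 :=
    Real.continuous_ofDigits.comp (continuous_pi fun k =>
      (continuous_of_discreteTopology (f := fun d : D => d.1.2)).comp (continuous_apply k))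
  refine (PiLp.continuous_toLp 2 _).comp (continuous_pi fun j => ?_)
  fin_cases j
  · exact h1
  · exact h2

theorem codingMap_eq_carpetMap {m n : ℕ} (D : Finset (Fin m × Fin n)) (i : ℕ → D) :
    codingMap D i = carpetMap (i 0).1 (codingMap D fun k => i (k + 1)) := by
  have e : ∀ {b : ℕ} (d : ℕ → Fin b),
      Real.ofDigits d = (Real.ofDigits (fun k => d (k + 1)) + ((d 0 : ℕ) : ℝ)) / b := by
    intro b d
    rw [Real.ofDigits_eq_sum_add_ofDigits d 1]
    simp [Real.ofDigitsTerm]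
    ring
  simp only [codingMap, carpetMap, Matrix.cons_val_zero, Matrix.cons_val_one]
  rw [e fun k => (i k).1.1, e fun k => (i k).1.2]

theorem isBedfordMcMullenCarpet_range_codingMap {m n : ℕ} (D : Finset (Fin m × Fin n))
    [hD : Nonempty D] : IsBedfordMcMullenCarpet D (range (codingMap D)) := by
  refine ⟨?_, isCompact_range (continuous_codingMap D), ?_, ?_⟩
  · obtain ⟨ℓ⟩ := hD
    exact ⟨codingMap D fun _ => ℓ, mem_range_self _⟩
  · rintro _ ⟨i, rfl⟩ j
    fin_cases j
    · exact ⟨Real.ofDigits_nonneg _, Real.ofDigits_le_one _⟩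
    · exact ⟨Real.ofDigits_nonneg _, Real.ofDigits_le_one _⟩
  · ext z
    simp only [mem_iUnion, exists_prop]
    constructor
    · rintro ⟨i, rfl⟩
      exact ⟨(i 0).1, (i 0).2, _, mem_range_self _, (codingMap_eq_carpetMap D i).symm⟩
    · rintro ⟨ℓ, hℓ, _, ⟨i, rfl⟩, rfl⟩
      exact ⟨_, codingMap_eq_carpetMap D
        (fun k => Nat.casesOn (motive := fun _ => D) k ⟨ℓ, hℓ⟩ i)⟩

theorem IsBedfordMcMullenCarpet.eq_range_codingMap {m n : ℕ} (hm : 2 ≤ m) (hn : 2 ≤ n)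
    {D : Finset (Fin m × Fin n)} [Nonempty D] {F : Set (EuclideanSpace ℝ (Fin 2))}
    (hF : IsBedfordMcMullenCarpet D F) : F = range (codingMap D) :=
  have h := isBedfordMcMullenCarpet_range_codingMap D
  Subset.antisymm (hF.subset hm hn h) (h.subset hm hn hF)

/-- The integer whose base-`b` expansion is given by the first `k` digits of `d`, the leading digit
being `d 0`. -/
def prefixIndex {b : ℕ} (d : ℕ → Fin b) : ℕ → ℕ
  | 0 => 0
  | k + 1 => b * prefixIndex d k + d k

theorem eq_of_prefixIndex_eq {b : ℕ} {d e : ℕ → Fin b} {k : ℕ}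
    (h : prefixIndex d k = prefixIndex e k) : ∀ l < k, d l = e l := by
  induction k with
  | zero => simp
  | succ k ih =>
    simp only [prefixIndex] at h
    have hb : 0 < b := Fin.pos (d 0)
    have h1 : (d k : ℕ) = e k := by
      have := congrArg (· % b) h
      simpa [Nat.mul_add_mod, Nat.mod_eq_of_lt (d k).2, Nat.mod_eq_of_lt (e k).2] using this
    have h2 : prefixIndex d k = prefixIndex e k := by
      rw [h1] at h
      exact Nat.eq_of_mul_eq_mul_left hb (Nat.add_right_cancel h)
    intro l hl
    rcases Nat.lt_succ_iff_lt_or_eq.mp hl with hl | rfl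
    · exact ih h2 l hl
    · exact Fin.ext h1

theorem sum_ofDigitsTerm_eq {b : ℕ} (d : ℕ → Fin b) (k : ℕ) :
    ∑ i ∈ Finset.range k, Real.ofDigitsTerm d i = prefixIndex d k / (b : ℝ) ^ k := by
  have hb : (b : ℝ) ≠ 0 := by exact_mod_cast (Fin.pos (d 0)).ne'
  induction k with
  | zero => simp [prefixIndex]
  | succ k ih =>
    rw [Finset.sum_range_succ, ih, Real.ofDigitsTerm, prefixIndex]
    push_cast
    field_simp
    ring

theorem prefixIndex_le_ofDigits_mul {b : ℕ} (d : ℕ → Fin b) (k : ℕ) :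
    (prefixIndex d k : ℝ) ≤ Real.ofDigits d * b ^ k ∧
      Real.ofDigits d * b ^ k ≤ prefixIndex d k + 1 := by
  have hb : (0 : ℝ) < b := by exact_mod_cast Fin.pos (d 0)
  have hbk : (0 : ℝ) < (b : ℝ) ^ k := by positivity
  have h : Real.ofDigits d * b ^ k = prefixIndex d k + Real.ofDigits fun i => d (i + k) := by
    rw [Real.ofDigits_eq_sum_add_ofDigits d k, sum_ofDigitsTerm_eq]
    field_simp
  rw [h]
  exact ⟨le_add_of_nonneg_right (Real.ofDigits_nonneg _),
    add_le_add_right (Real.ofDigits_le_one _) _⟩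

/-- Numbers that are close at scale `b ^ (-k)` lie in the same or in nearby `b`-adic intervals. -/
theorem prefixIndex_le_add_two {b : ℕ} (d e : ℕ → Fin b) (k : ℕ)
    (h : |Real.ofDigits d - Real.ofDigits e| ≤ ((b : ℝ) ^ k)⁻¹) :
    prefixIndex d k ≤ prefixIndex e k + 2 := by
  have hb : (0 : ℝ) < b := by exact_mod_cast Fin.pos (d 0)
  have hbk : (0 : ℝ) < (b : ℝ) ^ k := by positivity
  have h1 := (prefixIndex_le_ofDigits_mul d k).1
  have h2 := (prefixIndex_le_ofDigits_mul e k).2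
  have h3 : (Real.ofDigits d - Real.ofDigits e) * (b : ℝ) ^ k ≤ 1 := by
    rw [← le_div_iff₀ hbk, one_div]
    exact (le_abs_self _).trans h
  have : (prefixIndex d k : ℝ) ≤ prefixIndex e k + 2 := by linarith
  exact_mod_cast this

/-! ### Approximate squares and McMullen's measure -/

/-- The symbolic approximate square around `ω`: the first `k` letters agree with those of `ω`, and
the column digits of the first `L` letters do. Its image under the coding map lies in a rectangle
of width `m ^ (-L)` and height `n ^ (-k)`. -/
def approxSquare {m n : ℕ} (D : Finset (Fin m × Fin n)) (k L : ℕ) (ω : ℕ → D) : Set (ℕ → D) :=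
  {ω' | (∀ l < k, ω' l = ω l) ∧ ∀ l < L, (ω' l).1.1 = (ω l).1.1}

theorem dist_codingMap_le {m n : ℕ} (D : Finset (Fin m × Fin n)) {k L : ℕ} {ω ω' : ℕ → D}
    (h : ω' ∈ approxSquare D k L ω) :
    dist (codingMap D ω') (codingMap D ω) ≤ ((m : ℝ) ^ L)⁻¹ + ((n : ℝ) ^ k)⁻¹ := by
  have h0 := Real.abs_ofDigits_sub_ofDigits_le (x := fun l => (ω' l).1.1)
    (y := fun l => (ω l).1.1) (n := L) h.2
  have h1 := Real.abs_ofDigits_sub_ofDigits_le (x := fun l => (ω' l).1.2)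
    (y := fun l => (ω l).1.2) (n := k) fun l hl => by rw [h.1 l hl]
  rw [EuclideanSpace.dist_eq, Fin.sum_univ_two]
  simp only [codingMap_apply_zero, codingMap_apply_one, Real.dist_eq]
  refine Real.sqrt_le_iff.mpr ⟨by positivity, ?_⟩
  have a0 := abs_nonneg ((Real.ofDigits fun k => (ω' k).1.1) - Real.ofDigits fun k => (ω k).1.1)
  have a1 := abs_nonneg ((Real.ofDigits fun k => (ω' k).1.2) - Real.ofDigits fun k => (ω k).1.2)
  nlinarith [mul_nonneg (a0.trans h0) (a1.trans h1)]

/-- The logarithm of the number of elements of `D` in the same column as `ℓ`. -/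
noncomputable def logColumn {m n : ℕ} (D : Finset (Fin m × Fin n)) (ℓ : D) : ℝ :=
  Real.log (columnCount D ℓ.1.1)

/-- The Birkhoff sum of `logColumn` over the first `k` letters of `ω`. -/
noncomputable def logColumnSum {m n : ℕ} (D : Finset (Fin m × Fin n)) (k : ℕ) (ω : ℕ → D) : ℝ :=
  ∑ l ∈ Finset.range k, logColumn D (ω l)

/-- The normalising constant `∑ a_ℓ ^ (log_n m - 1)` over `ℓ ∈ D`, which equals
`∑ n_p ^ (log_n m)` over the nonempty columns `p`. The dimension of the carpet is its logarithm to
base `m`. -/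
noncomputable def carpetMass {m n : ℕ} (D : Finset (Fin m × Fin n)) : ℝ :=
  ∑ ℓ : D, Real.exp ((Real.logb n m - 1) * logColumn D ℓ)

/-- The letter distribution of McMullen's measure: `ℓ` has weight proportional to
`a_ℓ ^ (log_n m - 1)`. -/
noncomputable def letterMeasure {m n : ℕ} (D : Finset (Fin m × Fin n)) : Measure D :=
  ∑ ℓ : D, ENNReal.ofReal (Real.exp ((Real.logb n m - 1) * logColumn D ℓ) / carpetMass D) •
    Measure.dirac ℓ

/-- McMullen's measure: the Bernoulli measure with letter distribution `letterMeasure D`. -/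
noncomputable def mcMullenMeasure {m n : ℕ} (D : Finset (Fin m × Fin n)) : Measure (ℕ → D) :=
  Measure.infinitePi fun _ => letterMeasure D

theorem columnCount_pos {m n : ℕ} {D : Finset (Fin m × Fin n)} (ℓ : D) :
    0 < columnCount D ℓ.1.1 :=
  Finset.card_pos.mpr ⟨ℓ.1, Finset.mem_filter.mpr ⟨ℓ.2, rfl⟩⟩

theorem exp_logColumn {m n : ℕ} (D : Finset (Fin m × Fin n)) (ℓ : D) :
    Real.exp (logColumn D ℓ) = columnCount D ℓ.1.1 :=
  Real.exp_log (by exact_mod_cast columnCount_pos ℓ)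

theorem logColumn_nonneg {m n : ℕ} (D : Finset (Fin m × Fin n)) (ℓ : D) : 0 ≤ logColumn D ℓ :=
  Real.log_natCast_nonneg _

theorem logColumn_le {m n : ℕ} (D : Finset (Fin m × Fin n)) (ℓ : D) :
    logColumn D ℓ ≤ Real.log (maxColumnCount D) := by
  refine Real.log_le_log (by exact_mod_cast columnCount_pos ℓ) ?_
  exact_mod_cast Finset.le_sup (f := fun ℓ : Fin m × Fin n => columnCount D ℓ.1) ℓ.2

theorem logColumnSum_nonneg {m n : ℕ} (D : Finset (Fin m × Fin n)) (k : ℕ) (ω : ℕ → D) :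
    0 ≤ logColumnSum D k ω :=
  Finset.sum_nonneg fun _ _ => logColumn_nonneg D _

theorem logColumnSum_le {m n : ℕ} (D : Finset (Fin m × Fin n)) (k : ℕ) (ω : ℕ → D) :
    logColumnSum D k ω ≤ k * Real.log (maxColumnCount D) := by
  simpa [logColumnSum] using Finset.sum_le_card_nsmul (Finset.range k) (fun l => logColumn D (ω l)) _
    fun l _ => logColumn_le D (ω l)

theorem sum_column_exp {m n : ℕ} (D : Finset (Fin m × Fin n)) (ℓ : D) (t : ℝ) :
    ∑ x : D, (if x.1.1 = ℓ.1.1 then Real.exp ((t - 1) * logColumn D x) else 0) =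
      Real.exp (t * logColumn D ℓ) := by
  have h : ∀ x : D, (if x.1.1 = ℓ.1.1 then Real.exp ((t - 1) * logColumn D x) else 0) =
      if x.1.1 = ℓ.1.1 then Real.exp ((t - 1) * logColumn D ℓ) else 0 := by
    intro x
    split_ifs with hx
    · simp only [logColumn, hx]
    · rfl
  rw [Finset.sum_congr rfl fun x _ => h x,
    Finset.sum_coe_sort D fun x => if x.1 = ℓ.1.1 then Real.exp ((t - 1) * logColumn D ℓ) else 0,
    ← Finset.sum_filter, Finset.sum_const, nsmul_eq_mul]
  change (columnCount D ℓ.1.1 : ℝ) * _ = _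
  rw [← exp_logColumn, ← Real.exp_add]
  congr 1
  ring

theorem one_le_carpetMass {m n : ℕ} (D : Finset (Fin m × Fin n)) [hD : Nonempty D] :
    1 ≤ carpetMass D := by
  obtain ⟨ℓ⟩ := hD
  have hlog : 0 ≤ Real.logb n m :=
    div_nonneg (Real.log_natCast_nonneg _) (Real.log_natCast_nonneg _)
  calc (1 : ℝ) ≤ Real.exp (Real.logb n m * logColumn D ℓ) :=
        Real.one_le_exp (mul_nonneg hlog (logColumn_nonneg D ℓ))
    _ ≤ carpetMass D := by
        rw [← sum_column_exp]
        refine Finset.sum_le_sum fun x _ => ?_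
        split_ifs
        · exact le_rfl
        · positivity

theorem carpetMass_pos {m n : ℕ} (D : Finset (Fin m × Fin n)) [Nonempty D] : 0 < carpetMass D :=
  Finset.sum_pos (fun _ _ => Real.exp_pos _) Finset.univ_nonempty

theorem letterMeasure_apply {m n : ℕ} (D : Finset (Fin m × Fin n)) (s : Set D)
    [DecidablePred (· ∈ s)] :
    letterMeasure D s = ENNReal.ofReal
      ((∑ x : D, if x ∈ s then Real.exp ((Real.logb n m - 1) * logColumn D x) else 0) /
        carpetMass D) := by
  have h0 : 0 ≤ carpetMass D := Finset.sum_nonneg fun _ _ => (Real.exp_pos _).le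
  rw [letterMeasure, Measure.coe_finsetSum, Finset.sum_apply, Finset.sum_div,
    ENNReal.ofReal_sum_of_nonneg]
  · refine Finset.sum_congr rfl fun x _ => ?_
    rw [Measure.smul_apply, Measure.dirac_apply, smul_eq_mul]
    by_cases hx : x ∈ s <;> simp [hx]
  · intro x _
    split_ifs <;> positivity

instance {m n : ℕ} (D : Finset (Fin m × Fin n)) [Nonempty D] :
    IsProbabilityMeasure (letterMeasure D) := by
  classical
  refine ⟨?_⟩
  rw [letterMeasure_apply]
  simp only [mem_univ, if_true]
  rw [← carpetMass, div_self (carpetMass_pos D).ne', ENNReal.ofReal_one]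

instance {m n : ℕ} (D : Finset (Fin m × Fin n)) [Nonempty D] :
    IsProbabilityMeasure (mcMullenMeasure D) := by
  unfold mcMullenMeasure
  infer_instance

/-- McMullen's formula for the mass of an approximate square. -/
theorem mcMullenMeasure_approxSquare {m n : ℕ} (D : Finset (Fin m × Fin n)) [Nonempty D]
    {k L : ℕ} (hkL : k ≤ L) (ω : ℕ → D) :
    mcMullenMeasure D (approxSquare D k L ω) = ENNReal.ofReal (Real.exp
      (Real.logb n m * logColumnSum D L ω - logColumnSum D k ω - L * Real.log (carpetMass D))) := by
  classical
  have hZ := carpetMass_pos D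
  have hset : approxSquare D k L ω = Set.pi (Finset.range L)
      fun l => if l < k then {ω l} else {x | x.1.1 = (ω l).1.1} := by
    ext ω'
    simp only [approxSquare, mem_ofPred_eq, Set.mem_pi, Finset.coe_range, mem_Iio]
    constructor
    · rintro ⟨h1, h2⟩ l hl
      split_ifs with hk
      · exact h1 l hk
      · exact h2 l hl
    · intro h
      refine ⟨fun l hl => ?_, fun l hl => ?_⟩
      · simpa [hl] using h l (hl.trans_le hkL)
      · have := h l hl
        split_ifs at this with hk
        · rw [mem_singleton_iff.mp this]
        · exact this
  have hfactor : ∀ l, letterMeasure D (if l < k then {ω l} else {x | x.1.1 = (ω l).1.1}) =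
      ENNReal.ofReal (Real.exp (Real.logb n m * logColumn D (ω l) -
        (if l < k then logColumn D (ω l) else 0) - Real.log (carpetMass D))) := by
    intro l
    rw [Real.exp_sub _ (Real.log _), Real.exp_log hZ]
    split_ifs with hk
    · rw [letterMeasure_apply]
      simp only [mem_singleton_iff, Finset.sum_ite_eq', Finset.mem_univ, if_true]
      ring_nf
    · rw [letterMeasure_apply]
      simp only [mem_ofPred_eq]
      rw [sum_column_exp, sub_zero]
  rw [hset, mcMullenMeasure, Measure.infinitePi_pi _ fun _ _ => MeasurableSet.of_discrete,
    Finset.prod_congr rfl fun l _ => hfactor l,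
    ← ENNReal.ofReal_prod_of_nonneg fun _ _ => (Real.exp_pos _).le, ← Real.exp_sum]
  congr 2
  rw [Finset.sum_sub_distrib, Finset.sum_sub_distrib, ← Finset.mul_sum, ← Finset.sum_filter,
    Finset.sum_const, Finset.card_range, nsmul_eq_mul]
  congr 2
  refine Finset.sum_congr ?_ fun _ _ => rfl
  ext l
  simp only [Finset.mem_filter, Finset.mem_range]
  omega

/-! ### The mass distribution principle -/

/-- The mass distribution principle, with the mass bound required along a geometric sequence of
scales only. -/
theorem le_dimH_of_forall_measure_le {X : Type*} [MetricSpace X] [MeasurableSpace X]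
    [BorelSpace X] (ν : Measure X) {F : Set X} (hνF : ν F ≠ 0) {s : ℝ≥0} (hs : 0 < s) {y C : ℝ}
    (hy0 : 0 < y) (hy1 : y < 1) (hC : 0 < C) (K : ℕ)
    (h : ∀ k : ℕ, K ≤ k → ∀ U : Set X, Metric.ediam U ≤ ENNReal.ofReal (y ^ k) →
      ν U ≤ ENNReal.ofReal (C * (y ^ k) ^ (s : ℝ))) :
    (s : ℝ≥0∞) ≤ dimH F := by
  set C' : ℝ := C * (y⁻¹) ^ (s : ℝ) with hC'
  have hs' : (0 : ℝ) < s := hs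
  have hC'0 : 0 < C' := by positivity
  have hC'e : ENNReal.ofReal C' ≠ 0 := by simpa using hC'0
  have key : ∀ U : Set X, Metric.ediam U ≤ ENNReal.ofReal (y ^ K) →
      ν U ≤ ENNReal.ofReal C' * Metric.ediam U ^ (s : ℝ) := by
    intro U hU
    have hne : Metric.ediam U ≠ ∞ := ne_top_of_le_ne_top ENNReal.ofReal_ne_top hU
    by_cases h0 : Metric.ediam U = 0
    · have hlim : Tendsto (fun k : ℕ => ENNReal.ofReal (C * (y ^ k) ^ (s : ℝ))) atTop (𝓝 0) := by
        have h1 : Tendsto (fun k : ℕ => (y ^ k : ℝ)) atTop (𝓝 0) :=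
          tendsto_pow_atTop_nhds_zero_of_lt_one hy0.le hy1
        have h2 := (h1.rpow_const (p := (s : ℝ)) (Or.inr hs'.le)).const_mul C
        rw [Real.zero_rpow hs'.ne', mul_zero] at h2
        simpa using ENNReal.tendsto_ofReal h2
      have : ν U ≤ 0 := by
        refine ge_of_tendsto hlim ?_
        filter_upwards [eventually_ge_atTop K] with k hk
        exact h k hk U (by simp [h0])
      exact this.trans zero_le
    · set ρ := (Metric.ediam U).toReal with hρ
      have hρe : Metric.ediam U = ENNReal.ofReal ρ := (ENNReal.ofReal_toReal hne).symm
      have hρ0 : 0 < ρ := ENNReal.toReal_pos h0 hne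
      have hρK : ρ ≤ y ^ K := by
        rwa [hρe, ENNReal.ofReal_le_ofReal_iff (by positivity)] at hU
      obtain ⟨k, hk1, hk2⟩ := exists_nat_pow_near_of_lt_one hρ0
        (hρK.trans (pow_le_one₀ hy0.le hy1.le)) hy0 hy1
      have hKk : K ≤ k := by
        have := (pow_lt_pow_iff_right_of_lt_one₀ hy0 hy1).mp (hk1.trans_le hρK)
        omega
      refine (h k hKk U (by rw [hρe]; exact ENNReal.ofReal_le_ofReal hk2)).trans ?_
      rw [hρe, ENNReal.ofReal_rpow_of_pos hρ0, ← ENNReal.ofReal_mul hC'0.le]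
      refine ENNReal.ofReal_le_ofReal ?_
      rw [hC', mul_assoc, ← Real.mul_rpow (by positivity) hρ0.le]
      gcongr
      rw [inv_mul_eq_div, le_div_iff₀ hy0, ← pow_succ]
      exact hk1.le
  have hle : (ENNReal.ofReal C')⁻¹ • ν ≤ Measure.hausdorffMeasure (s : ℝ) := by
    refine Measure.le_hausdorffMeasure _ _ (ENNReal.ofReal (y ^ K)) (by simp; positivity)
      fun U hU => ?_
    rw [Measure.smul_apply, smul_eq_mul]
    calc (ENNReal.ofReal C')⁻¹ * ν U
        ≤ (ENNReal.ofReal C')⁻¹ * (ENNReal.ofReal C' * Metric.ediam U ^ (s : ℝ)) := by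
          gcongr
          exact key U hU
      _ = Metric.ediam U ^ (s : ℝ) := by
          rw [← mul_assoc, ENNReal.inv_mul_cancel hC'e ENNReal.ofReal_ne_top, one_mul]
  refine le_dimH_of_hausdorffMeasure_ne_zero fun h0 => hνF ?_
  have := (hle F).trans_eq h0
  rw [Measure.smul_apply, smul_eq_mul, nonpos_iff_eq_zero, mul_eq_zero] at this
  exact this.resolve_left (ENNReal.inv_ne_zero.mpr ENNReal.ofReal_ne_top)

/-! ### The dimension of the carpet is at least `log_m` of its mass -/

theorem ae_tendsto_logColumnSum_div {m n : ℕ} (D : Finset (Fin m × Fin n)) [Nonempty D] :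
    ∀ᵐ ω ∂mcMullenMeasure D, ∃ e : ℝ,
      Tendsto (fun k : ℕ => logColumnSum D k ω / k) atTop (𝓝 e) := by
  have hmeas : Measurable (logColumn D) := measurable_of_finite _
  have hX : ∀ j : ℕ, Measurable fun ω : ℕ → D => logColumn D (ω j) :=
    fun j => hmeas.comp (measurable_pi_apply j)
  have hb : ∀ ℓ, ‖logColumn D ℓ‖ ≤ Real.log (maxColumnCount D) := fun ℓ => by
    rw [Real.norm_of_nonneg (logColumn_nonneg D ℓ)]
    exact logColumn_le D ℓ
  have h := ProbabilityTheory.strong_law_ae_real (μ := mcMullenMeasure D)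
    (fun l ω => logColumn D (ω l))
    (Integrable.of_bound (hX 0).aestronglyMeasurable _ (Eventually.of_forall fun ω => hb (ω 0)))
    (fun i j hij => (ProbabilityTheory.iIndepFun_infinitePi (P := fun _ : ℕ => letterMeasure D)
      (X := fun _ => logColumn D) fun _ => hmeas).indepFun hij)
    (fun i => ⟨(hX i).aemeasurable, (hX 0).aemeasurable, by
      have e : ∀ j : ℕ, Measure.map (fun ω : ℕ → D => logColumn D (ω j)) (mcMullenMeasure D) =
          (letterMeasure D).map (logColumn D) := fun j => by
        rw [← Measure.infinitePi_map_eval (fun _ : ℕ => letterMeasure D) j,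
          Measure.map_map hmeas (by fun_prop)]
        rfl
      rw [e, e]⟩)
  filter_upwards [h] with ω hω
  exact ⟨_, hω⟩

/-- The number `L(k) = ⌊k log_m n⌋` of column digits that an approximate square of height
`n ^ (-k)` prescribes. -/
noncomputable def columnLevel (m n k : ℕ) : ℕ := ⌊Real.logb m n * k⌋₊

theorem one_lt_logb_of_lt {m n : ℕ} (hm : 2 ≤ m) (hmn : m < n) : 1 < Real.logb m n := by
  have hm1 : (1 : ℝ) < m := by exact_mod_cast hm
  have hm0 : (0 : ℝ) < m := by linarith
  rw [Real.lt_logb_iff_rpow_lt hm1 (hm0.trans (by exact_mod_cast hmn)), Real.rpow_one]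
  exact_mod_cast hmn

theorem columnLevel_le {m n : ℕ} (hm : 2 ≤ m) (hmn : m < n) (k : ℕ) :
    (columnLevel m n k : ℝ) ≤ Real.logb m n * k :=
  Nat.floor_le (mul_nonneg (zero_lt_one.trans (one_lt_logb_of_lt hm hmn)).le k.cast_nonneg)

theorem lt_columnLevel_add_one (m n k : ℕ) : Real.logb m n * k < columnLevel m n k + 1 :=
  Nat.lt_floor_add_one _

theorem le_columnLevel {m n : ℕ} (hm : 2 ≤ m) (hmn : m < n) (k : ℕ) : k ≤ columnLevel m n k :=
  Nat.le_floor (le_mul_of_one_le_left k.cast_nonneg (one_lt_logb_of_lt hm hmn).le)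

theorem pow_columnLevel_le {m n : ℕ} (hm : 2 ≤ m) (hmn : m < n) (k : ℕ) :
    (m : ℝ) ^ columnLevel m n k ≤ (n : ℝ) ^ k := by
  have hm1 : (1 : ℝ) < m := by exact_mod_cast hm
  have hn0 : (0 : ℝ) < n := by exact_mod_cast (by omega : 0 < n)
  have := Real.rpow_le_rpow_of_exponent_le hm1.le (columnLevel_le hm hmn k)
  rwa [Real.rpow_natCast, Real.rpow_mul (by linarith), Real.rpow_logb (by linarith) hm1.ne' hn0,
    Real.rpow_natCast] at this

theorem pow_le_mul_pow_columnLevel {m n : ℕ} (hm : 2 ≤ m) (hmn : m < n) (k : ℕ) :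
    (n : ℝ) ^ k ≤ m * (m : ℝ) ^ columnLevel m n k := by
  have hm1 : (1 : ℝ) < m := by exact_mod_cast hm
  have hn0 : (0 : ℝ) < n := by exact_mod_cast (by omega : 0 < n)
  have := Real.rpow_le_rpow_of_exponent_le hm1.le (lt_columnLevel_add_one m n k).le
  rwa [Real.rpow_mul (by linarith), Real.rpow_logb (by linarith) hm1.ne' hn0, Real.rpow_natCast,
    ← Nat.cast_add_one, Real.rpow_natCast, pow_succ'] at this

/-- A set of diameter at most `n ^ (-k)` meets the images of at most 25 approximate squares of
level `k`, hence carries at most 25 times the largest of their masses. -/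
theorem mcMullenMeasure_inter_preimage_le {m n : ℕ} (hm : 2 ≤ m) (hmn : m < n)
    (D : Finset (Fin m × Fin n)) (k : ℕ) (A : Set (ℕ → D)) (M : ℝ≥0∞)
    (hA : ∀ ω ∈ A, mcMullenMeasure D (approxSquare D k (columnLevel m n k) ω) ≤ M)
    (U : Set (EuclideanSpace ℝ (Fin 2)))
    (hU : Metric.ediam U ≤ ENNReal.ofReal (((n : ℝ) ^ k)⁻¹)) :
    mcMullenMeasure D (codingMap D ⁻¹' U ∩ A) ≤ 25 * M := by
  set L := columnLevel m n k
  rcases (codingMap D ⁻¹' U ∩ A).eq_empty_or_nonempty with h | ⟨ω₀, h₀U, -⟩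
  · rw [h, measure_empty]
    exact zero_le
  have hm0 : (0 : ℝ) < m := by exact_mod_cast (by omega : 0 < m)
  have hn0 : (0 : ℝ) < n := by exact_mod_cast (by omega : 0 < n)
  have hdist : ∀ ω ∈ codingMap D ⁻¹' U, ∀ ω' ∈ codingMap D ⁻¹' U, ∀ j,
      |codingMap D ω j - codingMap D ω' j| ≤ ((n : ℝ) ^ k)⁻¹ := by
    intro ω hω ω' hω' j
    have h1 := (Metric.edist_le_ediam_of_mem (s := U) hω hω').trans hU
    rw [edist_dist, ENNReal.ofReal_le_ofReal_iff (by positivity), dist_eq_norm] at h1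
    exact (PiLp.norm_apply_le (codingMap D ω - codingMap D ω') j).trans h1
  have hmk : ((n : ℝ) ^ k)⁻¹ ≤ ((m : ℝ) ^ L)⁻¹ :=
    inv_anti₀ (by positivity) (pow_columnLevel_le hm hmn k)
  let I : (ℕ → D) → ℕ := fun ω => prefixIndex (fun l => (ω l).1.1) L
  let J : (ℕ → D) → ℕ := fun ω => prefixIndex (fun l => (ω l).1.2) k
  have hI : ∀ ω ∈ codingMap D ⁻¹' U, ∀ ω' ∈ codingMap D ⁻¹' U, I ω ≤ I ω' + 2 :=
    fun ω hω ω' hω' => prefixIndex_le_add_two _ _ _ ((hdist ω hω ω' hω' 0).trans hmk)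
  have hJ : ∀ ω ∈ codingMap D ⁻¹' U, ∀ ω' ∈ codingMap D ⁻¹' U, J ω ≤ J ω' + 2 :=
    fun ω hω ω' hω' => prefixIndex_le_add_two _ _ _ (hdist ω hω ω' hω' 1)
  let B : Finset (ℕ × ℕ) :=
    Finset.Icc (I ω₀ - 2) (I ω₀ + 2) ×ˢ Finset.Icc (J ω₀ - 2) (J ω₀ + 2)
  have hB : B.card ≤ 25 := by
    simp only [B, Finset.card_product, Nat.card_Icc]
    exact (Nat.mul_le_mul (by omega : _ ≤ 5) (by omega : _ ≤ 5))
  have hsub : codingMap D ⁻¹' U ∩ A ⊆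
      ⋃ p ∈ B, {ω | ω ∈ A ∧ (I ω, J ω) = p} := by
    rintro ω ⟨hωU, hωA⟩
    refine mem_iUnion₂.mpr ⟨(I ω, J ω), ?_, hωA, rfl⟩
    have h1 := hI ω hωU ω₀ h₀U
    have h2 := hI ω₀ h₀U ω hωU
    have h3 := hJ ω hωU ω₀ h₀U
    have h4 := hJ ω₀ h₀U ω hωU
    simp only [B, Finset.mem_product, Finset.mem_Icc]
    omega
  have hpiece : ∀ p, mcMullenMeasure D {ω | ω ∈ A ∧ (I ω, J ω) = p} ≤ M := by
    intro p
    rcases {ω | ω ∈ A ∧ (I ω, J ω) = p}.eq_empty_or_nonempty with h | ⟨ω₁, h₁A, h₁p⟩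
    · rw [h, measure_empty]
      exact zero_le
    refine (measure_mono ?_).trans (hA ω₁ h₁A)
    rintro ω ⟨-, hp⟩
    obtain ⟨hIe, hJe⟩ := Prod.mk.inj (hp.trans h₁p.symm)
    have hx := eq_of_prefixIndex_eq hIe
    have hy := eq_of_prefixIndex_eq hJe
    exact ⟨fun l hl => Subtype.ext (Prod.ext (hx l (hl.trans_le (le_columnLevel hm hmn k)))
      (hy l hl)), hx⟩
  calc mcMullenMeasure D (codingMap D ⁻¹' U ∩ A)
      ≤ ∑ p ∈ B, mcMullenMeasure D {ω | ω ∈ A ∧ (I ω, J ω) = p} :=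
        (measure_mono hsub).trans (measure_biUnion_finset_le _ _)
    _ ≤ B.card • M := Finset.sum_le_card_nsmul _ _ _ fun p _ => hpiece p
    _ ≤ 25 * M := by
        rw [nsmul_eq_mul]
        gcongr
        exact_mod_cast hB

theorem logb_mul_logb_comm {m n : ℕ} (hm : 2 ≤ m) (hmn : m < n) :
    Real.logb n m * Real.logb m n = 1 := by
  have hm0 : 0 < Real.log m := Real.log_pos (by exact_mod_cast hm)
  have hn0 : 0 < Real.log n := Real.log_pos (by exact_mod_cast (by omega : 1 < n))
  rw [Real.logb, Real.logb]
  field_simp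

/-- Up to the rounding of `L(k)`, the logarithm of the mass of an approximate square exceeds
`-k d log n`, where `Z` is the mass of the carpet and `d = log_m Z`, by at most `k` times the
difference of two Birkhoff averages. -/
theorem log_approxSquare_le {m n : ℕ} (hm : 2 ≤ m) (hmn : m < n) (D : Finset (Fin m × Fin n))
    [Nonempty D] {k : ℕ} (hk : 1 ≤ k) (ω : ℕ → D) :
    Real.logb n m * logColumnSum D (columnLevel m n k) ω - logColumnSum D k ω -
      columnLevel m n k * Real.log (carpetMass D) ≤
    k * (logColumnSum D (columnLevel m n k) ω / columnLevel m n k - logColumnSum D k ω / k) -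
      k * (Real.logb m n * Real.log (carpetMass D)) + Real.log (carpetMass D) := by
  set L := columnLevel m n k with hL
  have hk0 : (0 : ℝ) < k := by exact_mod_cast hk
  have hL0 : (0 : ℝ) < L := by exact_mod_cast hk.trans (le_columnLevel hm hmn k)
  have hS := logColumnSum_nonneg D L ω
  have h1 : Real.logb n m * logColumnSum D L ω ≤ k * (logColumnSum D L ω / L) := by
    have hα : Real.logb n m * L ≤ k := by
      have hα0 : 0 ≤ Real.logb n m :=
        div_nonneg (Real.log_natCast_nonneg _) (Real.log_natCast_nonneg _)
      calc Real.logb n m * L ≤ Real.logb n m * (Real.logb m n * k) := by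
            gcongr
            exact columnLevel_le hm hmn k
        _ = k := by rw [← mul_assoc, logb_mul_logb_comm hm hmn, one_mul]
    rw [mul_div_assoc', le_div_iff₀ hL0]
    nlinarith
  have h2 : (k : ℝ) * (logColumnSum D k ω / k) = logColumnSum D k ω := by field_simp
  have h3 : 0 ≤ Real.log (carpetMass D) := Real.log_nonneg (one_le_carpetMass D)
  have h4 := lt_columnLevel_add_one m n k
  rw [mul_sub, h2]
  nlinarith

/-- By the strong law of large numbers the two Birkhoff averages have the same limit almost surely,
so that McMullen's measure has lower local dimension at least `log_m Z` almost everywhere. -/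
theorem le_dimH_range_codingMap {m n : ℕ} (hm : 2 ≤ m) (hmn : m < n)
    (D : Finset (Fin m × Fin n)) [Nonempty D] {s : ℝ≥0} (hs : 0 < s)
    (hsd : (s : ℝ) < Real.logb m (carpetMass D)) :
    (s : ℝ≥0∞) ≤ dimH (range (codingMap D)) := by
  set Z := carpetMass D with hZ
  have hZ0 : 0 < Z := carpetMass_pos D
  have hm0 : 0 < Real.log m := Real.log_pos (by exact_mod_cast hm)
  have hn1 : (1 : ℝ) < n := by exact_mod_cast (by omega : 1 < n)
  have hn0 : 0 < Real.log n := Real.log_pos hn1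
  have hn : (0 : ℝ) < n := by linarith
  set η : ℝ := (Real.logb m Z - s) * Real.log n with hη
  have hη0 : 0 < η := mul_pos (by linarith) hn0
  let A : ℕ → Set (ℕ → D) := fun K => {ω | ∀ k, K ≤ k →
    logColumnSum D (columnLevel m n k) ω / columnLevel m n k - logColumnSum D k ω / k ≤ η}
  have hA : ∀ᵐ ω ∂mcMullenMeasure D, ω ∈ ⋃ K, A K := by
    filter_upwards [ae_tendsto_logColumnSum_div D] with ω ⟨e, he⟩
    have hL : Tendsto (columnLevel m n) atTop atTop :=
      tendsto_atTop_mono (le_columnLevel hm hmn) tendsto_id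
    have hd := (he.comp hL).sub he
    rw [sub_self] at hd
    obtain ⟨K, hK⟩ := eventually_atTop.mp (hd.eventually (eventually_le_nhds hη0))
    exact mem_iUnion.mpr ⟨K, hK⟩
  obtain ⟨K, hK⟩ : ∃ K, mcMullenMeasure D (A K) ≠ 0 := by
    by_contra! h
    have h1 : mcMullenMeasure D (⋃ K, A K) = 0 := measure_iUnion_null h
    have h2 := (prob_compl_eq_one_iff₀ (NullMeasurableSet.of_null h1)).mpr h1
    have h3 : mcMullenMeasure D (⋃ K, A K)ᶜ = 0 := hA
    exact zero_ne_one (h3.symm.trans h2)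
  have hmeas : Measurable (codingMap D) := (continuous_codingMap D).measurable
  let ν : Measure (EuclideanSpace ℝ (Fin 2)) := ((mcMullenMeasure D).restrict (A K)).map (codingMap D)
  have hνF : ν (range (codingMap D)) ≠ 0 := by
    rw [Measure.map_apply hmeas (isCompact_range (continuous_codingMap D)).measurableSet,
      preimage_range, Measure.restrict_apply_univ]
    exact hK
  refine le_dimH_of_forall_measure_le ν hνF hs (y := (n : ℝ)⁻¹) (C := 25 * Z) (by positivity)
    (inv_lt_one_of_one_lt₀ hn1) (by positivity) (max K 1) fun k hk U hU => ?_
  have hmass : ∀ ω ∈ A K, mcMullenMeasure D (approxSquare D k (columnLevel m n k) ω) ≤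
      ENNReal.ofReal (Z * ((n : ℝ)⁻¹ ^ k) ^ (s : ℝ)) := by
    intro ω hω
    rw [mcMullenMeasure_approxSquare D (le_columnLevel hm hmn k)]
    refine ENNReal.ofReal_le_ofReal ?_
    have e : Z * ((n : ℝ)⁻¹ ^ k) ^ (s : ℝ) = Real.exp (Real.log Z - k * (s * Real.log n)) := by
      rw [Real.exp_sub, Real.exp_log hZ0, Real.rpow_def_of_pos (by positivity), Real.log_pow,
        Real.log_inv, div_eq_mul_inv, ← Real.exp_neg]
      ring_nf
    rw [e, Real.exp_le_exp]
    refine (log_approxSquare_le hm hmn D ((le_max_right _ _).trans hk) ω).trans ?_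
    have h1 := mul_le_mul_of_nonneg_left (hω k ((le_max_left _ _).trans hk)) (k.cast_nonneg (α := ℝ))
    have h2 : Real.logb m n * Real.log Z = Real.logb m Z * Real.log n := by
      rw [Real.logb, Real.logb]; ring
    rw [← hZ, h2]
    rw [hη] at h1
    nlinarith
  calc ν U ≤ ν (closure U) := measure_mono subset_closure
    _ = mcMullenMeasure D (codingMap D ⁻¹' closure U ∩ A K) := by
        rw [Measure.map_apply hmeas isClosed_closure.measurableSet,
          Measure.restrict_apply (hmeas isClosed_closure.measurableSet)]
    _ ≤ 25 * ENNReal.ofReal (Z * ((n : ℝ)⁻¹ ^ k) ^ (s : ℝ)) := by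
        refine mcMullenMeasure_inter_preimage_le hm hmn D k (A K) _ hmass _ ?_
        rw [Metric.ediam_closure, ← inv_pow]
        exact hU
    _ = ENNReal.ofReal (25 * Z * ((n : ℝ)⁻¹ ^ k) ^ (s : ℝ)) := by
        rw [mul_assoc, ENNReal.ofReal_mul (p := 25) (by norm_num), ENNReal.ofReal_ofNat]

/-! ### Covers by approximate squares of large mass -/

/-- The counterpart of `log_approxSquare_le` from below. -/
theorem le_log_approxSquare {m n : ℕ} (hm : 2 ≤ m) (hmn : m < n) (D : Finset (Fin m × Fin n))
    [Nonempty D] {k : ℕ} (hk : 1 ≤ k) (ω : ℕ → D) :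
    k * (logColumnSum D (columnLevel m n k) ω / columnLevel m n k - logColumnSum D k ω / k) -
      k * (Real.logb m n * Real.log (carpetMass D)) - Real.log (maxColumnCount D) ≤
    Real.logb n m * logColumnSum D (columnLevel m n k) ω - logColumnSum D k ω -
      columnLevel m n k * Real.log (carpetMass D) := by
  set L := columnLevel m n k with hL
  have hk0 : (0 : ℝ) < k := by exact_mod_cast hk
  have hL0 : (0 : ℝ) < L := by exact_mod_cast hk.trans (le_columnLevel hm hmn k)
  set x := logColumnSum D L ω / L with hx
  have hx0 : 0 ≤ x := div_nonneg (logColumnSum_nonneg D L ω) hL0.le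
  have hxa : x ≤ Real.log (maxColumnCount D) := by
    rw [hx, div_le_iff₀ hL0, mul_comm]
    exact logColumnSum_le D L ω
  have hS : logColumnSum D L ω = x * L := by rw [hx]; field_simp
  have hc := one_lt_logb_of_lt hm hmn
  have hαc := logb_mul_logb_comm hm hmn
  have hα0 : 0 ≤ Real.logb n m :=
    div_nonneg (Real.log_natCast_nonneg _) (Real.log_natCast_nonneg _)
  have hα1 : Real.logb n m ≤ 1 := by nlinarith
  have hkL : (k : ℝ) ≤ Real.logb n m * (L + 1) := by
    calc (k : ℝ) = Real.logb n m * (Real.logb m n * k) := by rw [← mul_assoc, hαc, one_mul]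
      _ ≤ Real.logb n m * (L + 1) := by
        gcongr
        exact (lt_columnLevel_add_one m n k).le
  have h1 : k * x ≤ Real.logb n m * (x * L) + x := by
    nlinarith [mul_le_mul_of_nonneg_right hkL hx0, mul_le_mul_of_nonneg_right hα1 hx0]
  have h2 : (k : ℝ) * (logColumnSum D k ω / k) = logColumnSum D k ω := by field_simp
  have h3 : 0 ≤ Real.log (carpetMass D) := Real.log_nonneg (one_le_carpetMass D)
  have h4 := mul_le_mul_of_nonneg_right (columnLevel_le hm hmn k) h3
  rw [mul_sub, h2, hS]
  linarith

/-- Since distinct approximate squares of one level are disjoint, at most `t⁻¹` of them have mass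
at least `t`. -/
theorem exists_finset_approxSquare {m n : ℕ} (D : Finset (Fin m × Fin n)) [Nonempty D]
    (k L : ℕ) {t : ℝ} (ht : 0 < t) :
    ∃ T : Finset (ℕ → D), (T.card : ℝ) * t ≤ 1 ∧
      ∀ ω, ENNReal.ofReal t ≤ mcMullenMeasure D (approxSquare D k L ω) →
        ∃ ω' ∈ T, ω ∈ approxSquare D k L ω' := by
  classical
  let code : (ℕ → D) → (Fin k → D) × (Fin L → Fin m) :=
    fun ω => (fun l => ω l, fun l => (ω l).1.1)
  have hcol : Measurable fun x : D => x.1.1 := measurable_of_finite _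
  have hcode : Measurable code := by
    refine Measurable.prodMk (by fun_prop) ?_
    exact measurable_pi_lambda _ fun l => hcol.comp (measurable_pi_apply _)
  have hpre : ∀ ω, code ⁻¹' {code ω} = approxSquare D k L ω := by
    intro ω
    ext ω'
    simp only [mem_preimage, mem_singleton_iff, code, Prod.mk.injEq, funext_iff, approxSquare,
      mem_ofPred_eq]
    exact ⟨fun h => ⟨fun l hl => h.1 ⟨l, hl⟩, fun l hl => h.2 ⟨l, hl⟩⟩,
      fun h => ⟨fun l => h.1 l l.2, fun l => h.2 l l.2⟩⟩
  let W := Finset.univ.filter fun w => ENNReal.ofReal t ≤ mcMullenMeasure D (code ⁻¹' {w})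
  have hW : (W.card : ℝ) * t ≤ 1 := by
    have h1 : W.card • ENNReal.ofReal t ≤ ∑ w ∈ W, mcMullenMeasure D (code ⁻¹' {w}) :=
      Finset.card_nsmul_le_sum _ _ _ fun w hw => (Finset.mem_filter.mp hw).2
    rw [sum_measure_preimage_singleton _ fun w _ => hcode (measurableSet_singleton w)] at h1
    have h2 := h1.trans prob_le_one
    rwa [nsmul_eq_mul, ← ENNReal.ofReal_natCast, ← ENNReal.ofReal_mul (by positivity),
      ← ENNReal.ofReal_one, ENNReal.ofReal_le_ofReal_iff zero_le_one] at h2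
  let g := Function.invFun code
  refine ⟨W.image g, ?_, fun ω hω => ⟨g (code ω), ?_, ?_⟩⟩
  · refine le_trans ?_ hW
    gcongr
    exact Finset.card_image_le
  · refine Finset.mem_image_of_mem _ (Finset.mem_filter.mpr ⟨Finset.mem_univ _, ?_⟩)
    rwa [hpre]
  · rw [← hpre]
    exact (Function.invFun_eq ⟨ω, rfl⟩).symm

/-- Along the levels `K, L(K), L(L(K)), …` the differences of consecutive Birkhoff averages
telescope, so one of the first `r` of them is at least `-(log a) / r`. -/
theorem exists_lt_logColumnSum_div_sub {m n : ℕ} (D : Finset (Fin m × Fin n)) (k : ℕ → ℕ)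
    {r : ℕ} (hr : 1 ≤ r) (ω : ℕ → D) :
    ∃ j < r, -(Real.log (maxColumnCount D) / r) ≤
      logColumnSum D (k (j + 1)) ω / k (j + 1) - logColumnSum D (k j) ω / k j := by
  by_contra! h
  have hr0 : (0 : ℝ) < r := by exact_mod_cast hr
  have h1 := Finset.sum_lt_sum_of_nonempty (Finset.nonempty_range_iff.mpr (by omega : r ≠ 0))
    fun j hj => h j (Finset.mem_range.mp hj)
  rw [Finset.sum_range_sub (fun j => logColumnSum D (k j) ω / k j), Finset.sum_const,
    Finset.card_range, nsmul_eq_mul, mul_neg, mul_div_cancel₀ _ hr0.ne'] at h1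
  have h2 : 0 ≤ logColumnSum D (k r) ω / k r :=
    div_nonneg (logColumnSum_nonneg D _ ω) (Nat.cast_nonneg _)
  have h3 : logColumnSum D (k 0) ω / k 0 ≤ Real.log (maxColumnCount D) := by
    refine div_le_of_le_mul₀ (Nat.cast_nonneg _) (Real.log_natCast_nonneg _) ?_
    rw [mul_comm]
    exact logColumnSum_le D _ ω
  linarith

theorem le_iterate_columnLevel {m n : ℕ} (hm : 2 ≤ m) (hmn : m < n) (K j : ℕ) :
    K ≤ (columnLevel m n)^[j] K := by
  induction j with
  | zero => simp
  | succ j ih =>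
    rw [Function.iterate_succ_apply']
    exact ih.trans (le_columnLevel hm hmn _)

theorem iterate_columnLevel_le {m n : ℕ} (hm : 2 ≤ m) (hmn : m < n) (K j : ℕ) :
    ((columnLevel m n)^[j] K : ℝ) ≤ Real.logb m n ^ j * K := by
  have hc := one_lt_logb_of_lt hm hmn
  induction j with
  | zero => simp
  | succ j ih =>
    rw [Function.iterate_succ_apply', pow_succ', mul_assoc]
    refine (columnLevel_le hm hmn _).trans ?_
    gcongr

/-- The codings of the carpet are covered by boundedly many families of balls, one for each of the
levels `K, L(K), …` : the family of level `k` has at most `a n ^ (k β)` balls of radius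
`(m + 1) n ^ (-k)`. -/
theorem exists_cover_codingMap {m n : ℕ} (hm : 2 ≤ m) (hmn : m < n) (D : Finset (Fin m × Fin n))
    [Nonempty D] {r : ℕ} (hr : 1 ≤ r) {β : ℝ}
    (hβ : β = Real.logb m (carpetMass D) + Real.log (maxColumnCount D) / (r * Real.log n))
    {K : ℕ} (hK : 1 ≤ K) :
    ∃ T : Fin r → Finset (ℕ → D),
      (∀ j, ((T j).card : ℝ) ≤ maxColumnCount D *
        ((n : ℝ) ^ (columnLevel m n)^[j] K) ^ β) ∧
      range (codingMap D) ⊆ ⋃ j, ⋃ ω ∈ T j, Metric.closedBall (codingMap D ω)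
        ((m + 1) * ((n : ℝ) ^ (columnLevel m n)^[j] K)⁻¹) := by
  have hn1 : (1 : ℝ) < n := by exact_mod_cast (by omega : 1 < n)
  have hn : (0 : ℝ) < n := by linarith
  have hm0 : (0 : ℝ) < m := by exact_mod_cast (by omega : 0 < m)
  have hlogn : 0 < Real.log n := Real.log_pos hn1
  have hr0 : (0 : ℝ) < r := by exact_mod_cast hr
  have ha : (0 : ℝ) < maxColumnCount D := by
    obtain ⟨ℓ⟩ := ‹Nonempty D›
    have h1 := Finset.le_sup (f := fun ℓ : Fin m × Fin n => columnCount D ℓ.1) ℓ.2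
    exact_mod_cast (columnCount_pos ℓ).trans_le h1
  set κ : ℕ → ℕ := fun j => (columnLevel m n)^[j] K with hκ
  have hκ1 : ∀ j, 1 ≤ κ j := fun j => hK.trans (le_iterate_columnLevel hm hmn K j)
  have hκs : ∀ j, κ (j + 1) = columnLevel m n (κ j) := fun j => Function.iterate_succ_apply' _ _ _
  let t : ℕ → ℝ := fun k => ((maxColumnCount D : ℝ) * ((n : ℝ) ^ k) ^ β)⁻¹
  have ht : ∀ k, 0 < t k := fun k => by positivity
  have htexp : ∀ k, t k = Real.exp (-(k * (β * Real.log n)) - Real.log (maxColumnCount D)) := by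
    intro k
    simp only [t]
    rw [Real.exp_sub, Real.exp_log ha, Real.rpow_def_of_pos (by positivity), Real.log_pow,
      Real.exp_neg, mul_inv, div_eq_mul_inv, mul_comm]
    ring_nf
  choose T hT1 hT2 using fun k => exists_finset_approxSquare D k (columnLevel m n k) (ht k)
  refine ⟨fun j => T (κ j), fun j => ?_, ?_⟩
  · have h := hT1 (κ j)
    rwa [← div_eq_mul_inv, div_le_one (by positivity)] at h
  · rintro _ ⟨ω, rfl⟩
    obtain ⟨j, hj, hdiff⟩ := exists_lt_logColumnSum_div_sub D κ hr ω
    have hmass : ENNReal.ofReal (t (κ j)) ≤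
        mcMullenMeasure D (approxSquare D (κ j) (columnLevel m n (κ j)) ω) := by
      rw [mcMullenMeasure_approxSquare D (le_columnLevel hm hmn _), htexp]
      refine ENNReal.ofReal_le_ofReal (Real.exp_le_exp.mpr ?_)
      refine le_trans ?_ (le_log_approxSquare hm hmn D (hκ1 j) ω)
      have h1 := mul_le_mul_of_nonneg_left hdiff (Nat.cast_nonneg (α := ℝ) (κ j))
      rw [hκs] at h1
      have h2 : β * Real.log n = Real.logb m n * Real.log (carpetMass D) +
          Real.log (maxColumnCount D) / r := by
        rw [hβ, Real.logb, Real.logb]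
        field_simp
      rw [h2]
      linarith
    obtain ⟨ω', hω', hmem⟩ := hT2 (κ j) ω hmass
    refine mem_iUnion.mpr ⟨⟨j, hj⟩, mem_iUnion₂.mpr ⟨ω', hω', ?_⟩⟩
    refine Metric.mem_closedBall.mpr ((dist_codingMap_le D hmem).trans ?_)
    have h3 : ((m : ℝ) ^ columnLevel m n (κ j))⁻¹ ≤ m * ((n : ℝ) ^ κ j)⁻¹ := by
      rw [← div_eq_mul_inv, le_div_iff₀ (by positivity), inv_mul_le_iff₀ (by positivity), mul_comm]
      exact pow_le_mul_pow_columnLevel hm hmn _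
    change _ ≤ ((m : ℝ) + 1) * ((n : ℝ) ^ κ j)⁻¹
    linarith

/-- If `K` is least with balls of level `K` of diameter less than `δ`, then the levels used lie between `K`
and about `(log_m n) ^ (r - 1) K`, so that for small `δ` all diameters lie in `[δ ^ (1 / θ), δ]`. -/
theorem upperIntermediateDim_range_codingMap_le {m n : ℕ} (hm : 2 ≤ m) (hmn : m < n)
    (D : Finset (Fin m × Fin n)) [Nonempty D] {θ : ℝ} {r : ℕ} (hr : 1 ≤ r)
    (hrθ : Real.logb m n ^ (r - 1) < 1 / θ) :
    upperIntermediateDim θ (range (codingMap D)) ≤ ENNReal.ofReal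
      (Real.logb m (carpetMass D) + Real.log (maxColumnCount D) / (r * Real.log n)) := by
  set β : ℝ := Real.logb m (carpetMass D) + Real.log (maxColumnCount D) / (r * Real.log n) with hβ
  refine ENNReal.le_of_forall_pos_le_add fun e he _ => ?_
  have hn1 : (1 : ℝ) < n := by exact_mod_cast (by omega : 1 < n)
  have hn : (0 : ℝ) < n := by linarith
  have hm0 : (0 : ℝ) < m := by exact_mod_cast (by omega : 0 < m)
  have hc := one_lt_logb_of_lt hm hmn
  have he' : (0 : ℝ) < e := he
  let s : ℝ≥0 := β.toNNReal + e
  have hsβ : 0 < (s : ℝ) - β := by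
    have := Real.le_coe_toNNReal β
    simp only [s, NNReal.coe_add]
    linarith
  have hs : ((s : ℝ≥0) : ℝ≥0∞) = ENNReal.ofReal β + e := by simp [s, ENNReal.ofReal]
  rw [← hs]
  refine iInf₂_le s fun ε hε => ?_
  set B : ℝ := 2 * (m + 1) with hB
  have hB0 : 0 < B := by positivity
  set γ : ℝ := Real.logb m n ^ (r - 1) with hγ
  have hγ0 : 0 < γ := by positivity
  -- the three smallness conditions on `δ`
  have hev : ∀ᶠ δ in 𝓝[>] (0 : ℝ), δ ≤ B ∧
      r * (maxColumnCount D * B ^ (s : ℝ) * (δ / B) ^ ((s : ℝ) - β)) ≤ ε ∧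
      δ ^ (1 / θ - γ) ≤ B * ((n * B) ^ γ)⁻¹ := by
    have hid : Tendsto (fun δ : ℝ => δ) (𝓝[>] 0) (𝓝 0) := nhdsWithin_le_nhds
    refine (hid.eventually (eventually_le_nhds hB0)).and (Eventually.and ?_ ?_)
    · have h1 : Tendsto (fun δ : ℝ => r * (maxColumnCount D * B ^ (s : ℝ) *
          (δ / B) ^ ((s : ℝ) - β))) (𝓝[>] 0) (𝓝 0) := by
        have h2 := (((hid.div_const B).rpow_const (p := (s : ℝ) - β) (Or.inr hsβ.le)).const_mul
          (maxColumnCount D * B ^ (s : ℝ))).const_mul (r : ℝ)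
        rwa [zero_div, Real.zero_rpow hsβ.ne', mul_zero, mul_zero] at h2
      exact h1.eventually (eventually_le_nhds hε)
    · have h1 : Tendsto (fun δ : ℝ => δ ^ (1 / θ - γ)) (𝓝[>] 0) (𝓝 0) := by
        have h2 := hid.rpow_const (p := 1 / θ - γ) (Or.inr (by linarith))
        rwa [Real.zero_rpow (by linarith)] at h2
      exact h1.eventually (eventually_le_nhds (by positivity))
  obtain ⟨δ₀, hδ₀, hsub⟩ := mem_nhdsGT_iff_exists_Ioc_subset.mp hev
  refine ⟨δ₀, hδ₀, fun δ hδ hδle => ?_⟩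
  obtain ⟨hδB, hδε, hδθ⟩ := hsub ⟨hδ, hδle⟩
  obtain ⟨K', hK1, hK2⟩ := exists_nat_pow_near_of_lt_one (div_pos hδ hB0)
    ((div_le_one hB0).mpr hδB) (inv_pos.mpr hn) (inv_lt_one_of_one_lt₀ hn1)
  set K := K' + 1 with hKdef
  have hKlow : δ / (n * B) ≤ ((n : ℝ) ^ K)⁻¹ := by
    rw [hKdef, pow_succ, mul_inv, ← inv_pow, div_mul_eq_div_div_swap, div_eq_mul_inv]
    gcongr
  obtain ⟨T, hTcard, hT⟩ := exists_cover_codingMap hm hmn D hr hβ (K := K) (by omega)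
  set κ : ℕ → ℕ := fun j => (columnLevel m n)^[j] K with hκ
  have hrad : ∀ j, ((n : ℝ) ^ κ j)⁻¹ ≤ δ / B := by
    intro j
    refine le_trans ?_ hK1.le
    rw [← inv_pow]
    exact pow_le_pow_of_le_one (by positivity) (inv_le_one_of_one_le₀ hn1.le)
      (le_iterate_columnLevel hm hmn K j)
  have hdiam : ∀ (j : ℕ) (ω : ℕ → D), Metric.ediam (Metric.closedBall (codingMap D ω)
      ((m + 1) * ((n : ℝ) ^ κ j)⁻¹)) = ENNReal.ofReal (B * ((n : ℝ) ^ κ j)⁻¹) := by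
    intro j ω
    rw [ediam_closedBall_eq _ (by positivity), hB, mul_assoc]
  have hlow : ∀ j < r, δ ^ (1 / θ) ≤ B * ((n : ℝ) ^ κ j)⁻¹ := by
    intro j hj
    have h1 : (κ j : ℝ) ≤ K * γ := by
      refine (iterate_columnLevel_le hm hmn K j).trans ?_
      rw [mul_comm]
      gcongr
      exact pow_le_pow_right₀ hc.le (by omega)
    calc δ ^ (1 / θ) = δ ^ (1 / θ - γ) * δ ^ γ := by
          rw [← Real.rpow_add hδ, sub_add_cancel]
      _ ≤ B * ((n * B) ^ γ)⁻¹ * δ ^ γ := by gcongr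
      _ = B * (δ / (n * B)) ^ γ := by
          rw [Real.div_rpow hδ.le (by positivity)]
          ring
      _ ≤ B * (((n : ℝ) ^ K)⁻¹) ^ γ := by gcongr
      _ ≤ B * ((n : ℝ) ^ κ j)⁻¹ := by
          gcongr
          rw [Real.inv_rpow (by positivity), ← Real.rpow_natCast, ← Real.rpow_natCast,
            ← Real.rpow_mul hn.le]
          exact inv_anti₀ (by positivity) (Real.rpow_le_rpow_of_exponent_le hn1.le h1)
  -- each level contributes at most a constant times `δ ^ (s - β)`
  have hterm : ∀ j : Fin r, ((T j).card : ℝ) * (B * ((n : ℝ) ^ κ j)⁻¹) ^ (s : ℝ) ≤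
      maxColumnCount D * B ^ (s : ℝ) * (δ / B) ^ ((s : ℝ) - β) := by
    intro j
    have hx : (0 : ℝ) < (n : ℝ) ^ κ j := by positivity
    calc ((T j).card : ℝ) * (B * ((n : ℝ) ^ κ j)⁻¹) ^ (s : ℝ)
        ≤ maxColumnCount D * ((n : ℝ) ^ κ j) ^ β * (B * ((n : ℝ) ^ κ j)⁻¹) ^ (s : ℝ) := by
          gcongr
          exact hTcard j
      _ = maxColumnCount D * B ^ (s : ℝ) * (((n : ℝ) ^ κ j)⁻¹) ^ ((s : ℝ) - β) := by
          rw [Real.mul_rpow hB0.le (by positivity), Real.rpow_sub (by positivity),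
            Real.inv_rpow hx.le β]
          field_simp
      _ ≤ maxColumnCount D * B ^ (s : ℝ) * (δ / B) ^ ((s : ℝ) - β) := by
          gcongr
          exact hrad j
  refine ⟨Σ j : Fin r, T j, inferInstance, fun p => Metric.closedBall (codingMap D p.2)
    ((m + 1) * ((n : ℝ) ^ κ p.1)⁻¹), ?_, ?_, ?_⟩
  · refine hT.trans ?_
    simp only [iUnion_subset_iff]
    exact fun j ω hω => subset_iUnion_of_subset ⟨j, ω, hω⟩ Subset.rfl
  · rintro ⟨j, ω⟩
    rw [hdiam]
    refine ⟨fun _ => ENNReal.ofReal_le_ofReal (hlow j j.2), ENNReal.ofReal_le_ofReal ?_⟩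
    have := mul_le_mul_of_nonneg_left (hrad j) hB0.le
    rwa [mul_div_cancel₀ _ hB0.ne'] at this
  · simp only [hdiam]
    rw [tsum_fintype, Fintype.sum_sigma]
    calc ∑ j : Fin r, ∑ _ω : T j, ENNReal.ofReal (B * ((n : ℝ) ^ κ j)⁻¹) ^ (s : ℝ)
        = ∑ j : Fin r, ENNReal.ofReal
            (((T j).card : ℝ) * (B * ((n : ℝ) ^ κ j)⁻¹) ^ (s : ℝ)) := by
          refine Finset.sum_congr rfl fun j _ => ?_
          rw [Finset.sum_const, Finset.card_univ, Fintype.card_coe, nsmul_eq_mul,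
            ENNReal.ofReal_rpow_of_pos (by positivity), ENNReal.ofReal_mul (Nat.cast_nonneg _),
            ENNReal.ofReal_natCast]
      _ ≤ ∑ _j : Fin r, ENNReal.ofReal
            (maxColumnCount D * B ^ (s : ℝ) * (δ / B) ^ ((s : ℝ) - β)) :=
          Finset.sum_le_sum fun j _ => ENNReal.ofReal_le_ofReal (hterm j)
      _ ≤ ENNReal.ofReal ε := by
          rw [Finset.sum_const, Finset.card_univ, Fintype.card_fin, nsmul_eq_mul,
            ← ENNReal.ofReal_natCast, ← ENNReal.ofReal_mul (by positivity)]
          exact ENNReal.ofReal_le_ofReal hδε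

/-! ### Continuity of the intermediate dimensions of the carpet -/

theorem upperIntermediateDim_range_codingMap_le_dimH_add {m n : ℕ} (hm : 2 ≤ m) (hmn : m < n)
    (D : Finset (Fin m × Fin n)) [Nonempty D] {θ : ℝ} (hθ : 0 < θ) (hθ1 : θ < 1) :
    upperIntermediateDim θ (range (codingMap D)) ≤ dimH (range (codingMap D)) +
      ENNReal.ofReal
        ((2 * Real.log (Real.logb m n) * Real.log (maxColumnCount D) / Real.log n) *
          (1 / -Real.log θ)) := by
  have hlogc : 0 < Real.log (Real.logb m n) := Real.log_pos (one_lt_logb_of_lt hm hmn)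
  have hlogθ : 0 < -Real.log θ := neg_pos.mpr (Real.log_neg hθ hθ1)
  have hlogn : 0 < Real.log n := Real.log_pos (by exact_mod_cast (by omega : 1 < n))
  have hloga : 0 ≤ Real.log (maxColumnCount D) := Real.log_natCast_nonneg _
  have hd : ENNReal.ofReal (Real.logb m (carpetMass D)) ≤ dimH (range (codingMap D)) := by
    refine le_of_forall_lt fun x hx => ?_
    obtain ⟨s, hxs, hs⟩ := ENNReal.lt_iff_exists_nnreal_btwn.mp hx
    refine hxs.trans_le (le_dimH_range_codingMap hm hmn D ?_ ?_)
    · exact_mod_cast (zero_le (a := x)).trans_lt hxs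
    · rwa [← ENNReal.ofReal_coe_nnreal, ENNReal.ofReal_lt_ofReal_iff_of_nonneg (NNReal.coe_nonneg s)] at hs
  -- `t` solves `(log_m n) ^ t = 1 / θ`; with `r` the rounded-up half of `t`, which accounts for the
  -- factor 2 in the bound, `r - 1 < t` holds
  set t : ℝ := -Real.log θ / Real.log (Real.logb m n) with ht
  have ht0 : 0 < t := div_pos hlogθ hlogc
  set r : ℕ := ⌈t / 2⌉₊ with hr
  have hr1 : 1 ≤ r := Nat.one_le_ceil_iff.mpr (by positivity)
  have hrt : t / 2 ≤ r := Nat.le_ceil _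
  have hr0 : (0 : ℝ) < r := by exact_mod_cast hr1
  have hrt' : (r : ℝ) < t / 2 + 1 := Nat.ceil_lt_add_one (by positivity)
  have hrθ : Real.logb m n ^ (r - 1) < 1 / θ := by
    have hc0 : 0 < Real.logb m n := zero_lt_one.trans (one_lt_logb_of_lt hm hmn)
    rw [← Real.log_lt_log_iff (by positivity) (by positivity), Real.log_pow, one_div, Real.log_inv,
      Nat.cast_sub hr1, Nat.cast_one, ← lt_div_iff₀ hlogc]
    linarith
  refine (upperIntermediateDim_range_codingMap_le hm hmn D hr1 hrθ).trans ?_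
  refine (ENNReal.ofReal_add_le).trans (add_le_add hd (ENNReal.ofReal_le_ofReal ?_))
  calc Real.log (maxColumnCount D) / (r * Real.log n)
      ≤ Real.log (maxColumnCount D) / (t / 2 * Real.log n) := by gcongr
    _ = _ := by
      rw [ht]
      field_simp

/-- Both intermediate dimensions are at least `dimH` and increase with `θ`, so their continuity at
`0` follows from an upper bound on the larger one. -/
theorem continuousWithinAt_zero_of_le_add_div_log {F : Set (EuclideanSpace ℝ (Fin 2))} {C : ℝ}
    (h : ∀ θ : ℝ, 0 < θ → θ < 1 →
      upperIntermediateDim θ F ≤ dimH F + ENNReal.ofReal (C * (1 / -Real.log θ)))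
    {f : ℝ → ℝ≥0∞} (hf : Monotone f) (hlow : ∀ θ, dimH F ≤ f θ)
    (hup : ∀ θ, f θ ≤ upperIntermediateDim θ F) :
    ContinuousWithinAt f (Icc 0 1) 0 := by
  have hlim : Tendsto (fun θ => dimH F + ENNReal.ofReal (C * (1 / -Real.log θ)))
      (𝓝[>] (0 : ℝ)) (𝓝 (dimH F)) := by
    have h1 : Tendsto (fun θ : ℝ => C * (1 / -Real.log θ)) (𝓝[>] 0) (𝓝 0) := by
      have h2 := (tendsto_neg_atBot_atTop.comp Real.tendsto_log_nhdsGT_zero).inv_tendsto_atTop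
      simpa [Function.comp_def, one_div] using h2.const_mul C
    simpa using (tendsto_const_nhds (x := dimH F)).add (ENNReal.tendsto_ofReal h1)
  have hbound : ∀ᶠ θ in 𝓝[>] (0 : ℝ), f θ ≤ dimH F + ENNReal.ofReal (C * (1 / -Real.log θ)) := by
    filter_upwards [Ioo_mem_nhdsGT (zero_lt_one (α := ℝ))] with θ hθ
    exact (hup θ).trans (h θ hθ.1 hθ.2)
  have h0 : f 0 = dimH F := by
    refine le_antisymm (ge_of_tendsto hlim ?_) (hlow 0)
    filter_upwards [hbound, self_mem_nhdsWithin] with θ hθ hθ0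
    exact (hf (le_of_lt hθ0)).trans hθ
  have hright : Tendsto f (𝓝[>] 0) (𝓝 (f 0)) := by
    rw [h0]
    exact tendsto_of_tendsto_of_tendsto_of_le_of_le' tendsto_const_nhds hlim
      (Eventually.of_forall hlow) hbound
  have : ContinuousWithinAt f (Ici 0) 0 := continuousWithinAt_Ioi_iff_Ici.mp hright
  exact this.mono Icc_subset_Ici_self

theorem proposition4p1 {m n : ℕ} (hm : 2 ≤ m) (hmn : m < n) (D : Finset (Fin m × Fin n))
    (hD : NonuniformColumns D) (F : Set (EuclideanSpace ℝ (Fin 2)))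
    (hF : IsBedfordMcMullenCarpet D F) :
    (∀ θ : ℝ, 0 < θ → θ < 1 / 4 * Real.logb n m ^ 2 →
      upperIntermediateDim θ F ≤ dimH F +
        ENNReal.ofReal
          ((2 * Real.log (Real.logb m n) * Real.log (maxColumnCount D) / Real.log n) *
            (1 / -Real.log θ))) ∧
    ContinuousWithinAt (fun θ : ℝ => lowerIntermediateDim θ F) (Icc 0 1) 0 ∧
    ContinuousWithinAt (fun θ : ℝ => upperIntermediateDim θ F) (Icc 0 1) 0 ∧
    ContinuousOn (fun θ : ℝ => lowerIntermediateDim θ F) (Icc 0 1) ∧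
    ContinuousOn (fun θ : ℝ => upperIntermediateDim θ F) (Icc 0 1) := by
  have : Nonempty D := by
    obtain ⟨p, -, hp, -⟩ := hD
    obtain ⟨ℓ, hℓ⟩ := Finset.card_pos.mp (Nat.pos_of_ne_zero hp)
    exact ⟨ℓ, (Finset.mem_filter.mp hℓ).1⟩
  have hbound : ∀ θ : ℝ, 0 < θ → θ < 1 → upperIntermediateDim θ F ≤ dimH F + ENNReal.ofReal
      ((2 * Real.log (Real.logb m n) * Real.log (maxColumnCount D) / Real.log n) *
        (1 / -Real.log θ)) := by
    intro θ hθ hθ1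
    rw [hF.eq_range_codingMap hm (by omega)]
    exact upperIntermediateDim_range_codingMap_le_dimH_add hm hmn D hθ hθ1
  have hlow0 := continuousWithinAt_zero_of_le_add_div_log hbound (lowerIntermediateDim_mono F)
    (fun θ => dimH_le_lowerIntermediateDim θ F)
    (fun θ => lowerIntermediateDim_le_upperIntermediateDim θ F)
  have hup0 := continuousWithinAt_zero_of_le_add_div_log hbound (upperIntermediateDim_mono F)
    (fun θ => (dimH_le_lowerIntermediateDim θ F).trans
      (lowerIntermediateDim_le_upperIntermediateDim θ F)) (fun θ => le_rfl)
  refine ⟨fun θ hθ hθ4 => hbound θ hθ ?_, hlow0, hup0, fun θ hθ => ?_, fun θ hθ => ?_⟩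
  · have hα0 : 0 ≤ Real.logb n m :=
      div_nonneg (Real.log_natCast_nonneg _) (Real.log_natCast_nonneg _)
    have hα1 : Real.logb n m ≤ 1 := by
      nlinarith [logb_mul_logb_comm hm hmn, one_lt_logb_of_lt hm hmn]
    nlinarith
  · rcases hθ.1.eq_or_lt with rfl | h0
    · exact hlow0
    · exact continuousWithinAt_of_monotone_of_div_mul_le (lowerIntermediateDim_mono F)
        (ofReal_mul_lowerIntermediateDim_le F) h0 hθ.2
  · rcases hθ.1.eq_or_lt with rfl | h0
    · exact hup0
    · exact continuousWithinAt_of_monotone_of_div_mul_le (upperIntermediateDim_mono F)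
        (ofReal_mul_upperIntermediateDim_le F) h0 hθ.2
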